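/- **Setting.** Let $\sigma^0=\mathbb I,\sigma^1,\sigma^2,\sigma^3$ be the Pauli matrices. Fix $k\in\{1,2,3\}$ and a number $n$ of qubits. Let $E$ be a finite set; each $e\in E$ carries an ordered pair of distinct qubits $(e_1,e_2)$ (several $e$ may have the same pair), a weight $w_e\ge 0$ and an orthogonal projector $P_e\in\mathbb C^{4\times4}$ on two qubits with $\operatorname{rank}P_e\ge k$. Put $H_e=w_eP_e\otimes\mathbb I_{[n]\setminus\{e_1,e_2\}}$, with $P_e$ acting on the qubits $e_1,e_2$. Suppose that every $P_e$ is strictly quadratic: $\operatorname{Tr}[(\sigma^a\otimes\mathbb I)P_e]=\operatorname{Tr}[(\mathbb I\otimes\sigma^a)P_e]=0$ for $a=1,2,3$, that is, the Pauli expansion of $P_e$ has no $1$-local terms. **Relaxation.** Index the rows and columns of real symmetric $(3n+1)\times(3n+1)$ matrices by $\mathbb I$ and the symbols $\sigma_i^a$ ($i\in[n]$, $a\in\{1,2,3\}$). Let $C_e$ be the symmetric matrix with $C_e(\sigma_{e_1}^a,\sigma_{e_2}^b)=\operatorname{Tr}[(\sigma^a\otimes\sigma^b)P_e]/8$, $C_e(\sigma_{e_1}^a,\mathbb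 I)=\operatorname{Tr}[(\sigma^a\otimes\mathbb I)P_e]/8$, $C_e(\sigma_{e_2}^b,\mathbb I)=\operatorname{Tr}[(\mathbb I\otimes\sigma^b)P_e]/8$, the entries obtained from these by symmetry, and all other entries $0$. Let $M^*$ be the $M$-part of an optimal solution of the semidefinite program that maximizes $$\sum_{e\in E}w_e\Big(\tfrac14\operatorname{Tr}[P_e]+\operatorname{Tr}[C_eM]\Big)$$ over real symmetric $M\succeq0$ and two-qubit density matrices $\rho_e$ ($e\in E$) subject to $M(\mathbb I,\mathbb I)=1$; $M(\sigma_i^a,\sigma_i^a)=1$; $M(\sigma_i^a,\sigma_i^b)=0$ for $a\ne b$; and, for all $e\in E$ and $a,b\in\{1,2,3\}$, $M(\sigma_{e_1}^a,\sigma_{e_2}^b)=\operatorname{Tr}[(\sigma^a\otimes\sigma^b)\rho_e]$, $M(\sigma_{e_1}^a,\mathbb I)=\operatorname{Tr}[(\sigma^a\otimes\mathbb I)\rho_e]$, $M(\sigma_{e_2}^b,\mathbb I)=\operatorname{Tr}[(\mathbb I\otimes\sigma^b)\rho_e]$. **Rounding.** Let $\mathbf v_0,\mathbf v_{ia}\in\mathbb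 R^d$ ($i\in[n]$, $a\in\{1,2,3\}$) be vectors whose Gram matrix is $M^*$ ($\mathbf v_0$ belonging to the index $\mathbb I$ and $\mathbf v_{ia}$ to $\sigma_i^a$). Draw $\mathbf r\sim\mathcal N(0,\mathbb I_d)$, put $Q_i=\big(\sum_{a=1}^3(\mathbf v_{ia}\cdot\mathbf r)^2\big)^{1/2}$ and $\theta_{ia}=\operatorname{sign}(\mathbf v_0\cdot\mathbf r)\,(\mathbf v_{ia}\cdot\mathbf r)/Q_i$, and output $$\rho=\bigotimes_{i=1}^n\tfrac12\big(\mathbb I+\theta_{i1}\sigma^1+\theta_{i2}\sigma^2+\theta_{i3}\sigma^3\big).$$ **Theorem.** The energy $\operatorname{Tr}\big[\sum_{e\in E}H_e\,\rho\big]$ is integrable and $$\mathbb E\Big[\operatorname{Tr}\Big[\sum_{e\in E}H_e\,\rho\Big]\Big]\ \ge\ \alpha(k)\,\lambda_{\max}\Big(\sum_{e\in E}H_e\Big),$$ where $\lambda_{\max}$ denotes the largest eigenvalue and $$\alpha(1)=\frac{22}{15\pi}\approx0.467,\qquad\alpha(2)=\frac13+\frac{24}{25\pi}\approx0.639,\qquad\alpha(3)=\frac12+\frac{388}{405\pi}\approx0.805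 .$$ -/

import Mathlib

open MeasureTheory ProbabilityTheory
open scoped Kronecker ComplexOrder

noncomputable section

/-- Operators on two qubits, in the computational basis. -/
abbrev TwoQubitOp : Type := Matrix (Fin 2 × Fin 2) (Fin 2 × Fin 2) ℂ

/-- Operators on `n` qubits; the computational basis is indexed by bit strings. -/
abbrev QubitOp (n : ℕ) : Type := Matrix (Fin n → Fin 2) (Fin n → Fin 2) ℂ

/-- The Pauli matrices `σ⁰ = 1, σ¹, σ², σ³`. -/
def pauli : Fin 4 → Matrix (Fin 2) (Fin 2) ℂ :=
  ![1, !![0, 1; 1, 0], !![0, -Complex.I; Complex.I, 0], !![1, 0; 0, -1]]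

/-- `Tr[(σᵏ ⊗ σˡ) A]`. -/
def pauliTrace (k l : Fin 4) (A : TwoQubitOp) : ℂ := ((pauli k ⊗ₖ pauli l) * A).trace

/-- The coefficient `Tr[(σᵏ ⊗ σˡ) A] / 4` of `σᵏ ⊗ σˡ` in the Pauli expansion of `A`. -/
def pauliCoeff (k l : Fin 4) (A : TwoQubitOp) : ℂ := pauliTrace k l A / 4

/-- Every two-qubit operator is the sum of its Pauli terms. -/
theorem pauli_expansion (A : TwoQubitOp) :
    A = ∑ k, ∑ l, pauliCoeff k l A • (pauli k ⊗ₖ pauli l) := by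
  ext ⟨a, b⟩ ⟨c, d⟩
  fin_cases a <;> fin_cases b <;> fin_cases c <;> fin_cases d <;>
    simp [pauliCoeff, pauliTrace, pauli, Matrix.trace, Matrix.mul_apply, Fin.sum_univ_four,
      Fintype.sum_prod_type] <;>
    ring_nf <;> simp [Complex.I_sq] <;> ring

/-- No `1`-local Pauli terms: the coefficients of `σᵏ ⊗ 1` and `1 ⊗ σˡ` vanish for `k, l ≠ 0`. -/
def StrictlyQuadratic (A : TwoQubitOp) : Prop :=
  (∀ k : Fin 4, k ≠ 0 → pauliCoeff k 0 A = 0) ∧ (∀ l : Fin 4, l ≠ 0 → pauliCoeff 0 l A = 0)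

/-- A density matrix: positive semidefinite (in particular Hermitian), of trace one. -/
def IsDensityMatrix {ι : Type*} [Fintype ι] (ρ : Matrix ι ι ℂ) : Prop :=
  ρ.PosSemidef ∧ ρ.trace = 1

/-- The operator `A ⊗ 1` on `n` qubits with `A` acting on qubits `i` and `j` (in this order). -/
def onQubits {n : ℕ} (i j : Fin n) (A : TwoQubitOp) : QubitOp n :=
  Matrix.of fun x y =>
    if ∀ m, m ≠ i → m ≠ j → x m = y m then A (x i, x j) (y i, y j) else 0

/-- The tensor product of one-qubit operators. -/
def tensorProd {n : ℕ} (ρ : Fin n → Matrix (Fin 2) (Fin 2) ℂ) : QubitOp n :=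
  Matrix.of fun x y => ∏ i, ρ i (x i) (y i)

/-- The largest eigenvalue (of a Hermitian matrix). -/
def lambdaMax {ι : Type*} [Fintype ι] [DecidableEq ι] (H : Matrix ι ι ℂ) : ℝ :=
  sSup (spectrum ℝ H)

/-- For a Hermitian matrix the supremum in `lambdaMax` is a maximum. -/
theorem lambdaMax_isGreatest {ι : Type*} [Fintype ι] [DecidableEq ι] [Nonempty ι]
    {H : Matrix ι ι ℂ} (hH : H.IsHermitian) : IsGreatest (spectrum ℝ H) (lambdaMax H) := by
  have h := hH.spectrum_real_eq_range_eigenvalues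
  have hf : (spectrum ℝ H).Finite := h ▸ Set.finite_range _
  have hn : (spectrum ℝ H).Nonempty := h ▸ Set.range_nonempty _
  exact ⟨hn.csSup_mem hf, fun _ hx => le_csSup hf.bddAbove hx⟩

/-- Weighted `2`-local terms `H_e = w_e O_e ⊗ 1` on `n` qubits, the operator `O_e` acting on two
distinct qubits `e₁ = fst e` and `e₂ = snd e`. Several `e` may have the same pair of qubits. -/
structure TwoLocalInstance (n : ℕ) (E : Type*) where
  fst : E → Fin n
  snd : E → Fin n
  fst_ne_snd : ∀ e, fst e ≠ snd e
  weight : E → ℝ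
  op : E → TwoQubitOp

namespace TwoLocalInstance

variable {n : ℕ} {E : Type*}

/-- The Hamiltonian `∑ₑ H_e`. -/
def hamiltonian [Fintype E] (I : TwoLocalInstance n E) : QubitOp n :=
  ∑ e, (I.weight e : ℂ) • onQubits (I.fst e) (I.snd e) (I.op e)

/-- Nonnegative weights, and each local operator is an orthogonal projector of rank at least `k`. -/
structure IsQLHP (I : TwoLocalInstance n E) (k : ℕ) : Prop where
  weight_nonneg : ∀ e, 0 ≤ I.weight e
  isProjector : ∀ e, IsStarProjection (I.op e)
  le_rank : ∀ e, k ≤ (I.op e).rank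

end TwoLocalInstance

/-- The index set of moment matrices: `none` is the identity, `some (i, k)` is the Pauli operator
`σᵢ^(k+1)` (for `k = 0, 1, 2`) on qubit `i`. -/
abbrev MomentIndex (n : ℕ) : Type := Option (Fin n × Fin 3)

/-- The real symmetric matrix with the non-identity Pauli coefficients (divided by two) of an
operator `A` acting on qubits `i` and `j`. -/
def valueMatrix {n : ℕ} (i j : Fin n) (A : TwoQubitOp) :
    Matrix (MomentIndex n) (MomentIndex n) ℝ :=
  let lin : Fin n × Fin 3 → ℝ := fun p =>
    if p.1 = i then (pauliTrace p.2.succ 0 A).re / 8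
    else if p.1 = j then (pauliTrace 0 p.2.succ A).re / 8
    else 0
  Matrix.of fun
    | none, none => 0
    | none, some p => lin p
    | some p, none => lin p
    | some p, some q =>
      if p.1 = i ∧ q.1 = j then (pauliTrace p.2.succ q.2.succ A).re / 8
      else if p.1 = j ∧ q.1 = i then (pauliTrace q.2.succ p.2.succ A).re / 8
      else 0

namespace TwoLocalInstance

variable {n : ℕ} {E : Type*}

/-- The constraints of the semidefinite relaxation: `M` is the moment matrix and `ρ e` the
two-qubit marginal on the qubits `fst e, snd e`. -/
structure SDPFeasible (I : TwoLocalInstance n E) (M : Matrix (MomentIndex n) (MomentIndex n) ℝ)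
    (ρ : E → TwoQubitOp) : Prop where
  one_one : M none none = 1
  diag : ∀ i k, M (some (i, k)) (some (i, k)) = 1
  diag_block : ∀ i k l, k ≠ l → M (some (i, k)) (some (i, l)) = 0
  marginal_two : ∀ e k l,
    (M (some (I.fst e, k)) (some (I.snd e, l)) : ℂ) = pauliTrace k.succ l.succ (ρ e)
  marginal_fst : ∀ e k, (M (some (I.fst e, k)) none : ℂ) = pauliTrace k.succ 0 (ρ e)
  marginal_snd : ∀ e l, (M (some (I.snd e, l)) none : ℂ) = pauliTrace 0 l.succ (ρ e)
  density : ∀ e, IsDensityMatrix (ρ e)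
  posSemidef : M.PosSemidef

/-- The objective `∑ₑ w_e (Tr[O_e] / 4 + Tr[C_e M])` of the semidefinite relaxation. -/
def sdpObjective [Fintype E] (I : TwoLocalInstance n E)
    (M : Matrix (MomentIndex n) (MomentIndex n) ℝ) : ℝ :=
  ∑ e, I.weight e *
    ((I.op e).trace.re / 4 + (valueMatrix (I.fst e) (I.snd e) (I.op e) * M).trace)

/-- `M` is the moment matrix of an optimal solution of the semidefinite relaxation. -/
def IsSDPOptimal [Fintype E] (I : TwoLocalInstance n E)
    (M : Matrix (MomentIndex n) (MomentIndex n) ℝ) : Prop :=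
  (∃ ρ, I.SDPFeasible M ρ) ∧
    ∀ M' ρ', I.SDPFeasible M' ρ' → I.sdpObjective M' ≤ I.sdpObjective M

end TwoLocalInstance

/-- `v` is a family of Cholesky vectors of `M`: the Gram matrix of `v` is `M`. -/
def IsCholesky {n d : ℕ} (M : Matrix (MomentIndex n) (MomentIndex n) ℝ)
    (v : MomentIndex n → EuclideanSpace ℝ (Fin d)) : Prop :=
  ∀ a b, M a b = inner ℝ (v a) (v b)

/-- The sign, with `sign 0 = 1`. -/
def sgn (x : ℝ) : ℝ := if 0 ≤ x then 1 else -1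

/-- The normalization `Qᵢ` of the rounding algorithm. -/
def roundingNorm {n d : ℕ} (v : MomentIndex n → EuclideanSpace ℝ (Fin d))
    (r : EuclideanSpace ℝ (Fin d)) (i : Fin n) : ℝ :=
  Real.sqrt (∑ k, inner ℝ (v (some (i, k))) r ^ 2)

/-- The Bloch coordinate `θᵢₖ` obtained from the Gaussian sample `r`. -/
def blochCoord {n d : ℕ} (v : MomentIndex n → EuclideanSpace ℝ (Fin d))
    (r : EuclideanSpace ℝ (Fin d)) (i : Fin n) (k : Fin 3) : ℝ :=
  sgn (inner ℝ (v none) r) * (inner ℝ (v (some (i, k))) r / roundingNorm v r i)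

/-- The product state output by the rounding algorithm on the Gaussian sample `r`. -/
def roundedState {n d : ℕ} (v : MomentIndex n → EuclideanSpace ℝ (Fin d))
    (r : EuclideanSpace ℝ (Fin d)) : QubitOp n :=
  tensorProd fun i =>
    (1 / 2 : ℂ) • (1 + ∑ k : Fin 3, (blochCoord v r i k : ℂ) • pauli k.succ)

/-- The energy `Tr[H ρ]` of the output state on the sample `r`. -/
def TwoLocalInstance.roundedEnergy {n d : ℕ} {E : Type*} [Fintype E] (I : TwoLocalInstance n E)
    (v : MomentIndex n → EuclideanSpace ℝ (Fin d)) (r : EuclideanSpace ℝ (Fin d)) : ℝ :=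
  (I.hamiltonian * roundedState v r).trace.re

/-- The approximation factors (only `k = 1, 2, 3` matter). -/
def alphaSQ : ℕ → ℝ
  | 1 => 22 / (15 * Real.pi)
  | 2 => 1 / 3 + 24 / (25 * Real.pi)
  | 3 => 1 / 2 + 388 / (405 * Real.pi)
  | _ => 0

end

/-! Both the energy of a product state and the semidefinite objective are sums over edges, so one
edge can be treated at a time. Let `P` be its projector, `m` its rank, `c` its matrix of two-point
correlations, `x` and `y` the vector triples of its two qubits (orthonormal by the constraints) and
`T` their matrix of inner products, a contraction. Without 1-local terms only products of two Bloch
coordinates enter, so the common sign cancels. The relaxation is worth `(m + ⟨c,T⟩)/4`, which lies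
in `[0,1]`. The rounding is worth `(m + E⟨c, f(X) f(Y)ᵀ⟩)/4` on average, where `f(v) = v/‖v‖` and
`X`, `Y` are standard Gaussians in ℝ³ with cross-covariance `T`.

Gaussian part (`integral_rounded_ge`). Write `f = p + g`, where `p(v) = A v - (A/10)(‖v‖² - 5) v` is
the Hermite truncation of `f` at degree 3 and `A² = 8/(9π)`. Then `E p(X) f(Y)ᵀ = A² (T + (‖T‖²T +
2TTᵀT)/50)` exactly, `g(X)` is uncorrelated with `p(Y)`, and for a partial isometry `R` the term
`E⟨R, g(X) g(Y)ᵀ⟩` is at least `-‖R‖² E‖g‖²/3` by the arithmetic-geometric mean inequality, with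
`E‖g‖² = 1 - 33A²/10`.

Algebraic part (`IsStarProjection.pauli_structure`, `exists_partialIsometry_scaling`). The Pauli
coefficients of `P² = P` say `‖c‖² = m(4-m)` and `adj c = (m-2) cᵀ`. Hence `c` is orthogonal for `m
= 1, 3`, twice a rank-one unit matrix for `m = 2`, and zero for `m = 4`: always a multiple of a
partial isometry.

What remains is an inequality for 3×3 contractions (`truncatedValue_ge`). Ranks above `k` are
harmless because `alphaSQ` increases, and the moment matrix of a top eigenvector is feasible, so the
semidefinite optimum dominates the largest eigenvalue (`lambdaMax_le_sdpObjective`). -/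

noncomputable section

/-! ### Polynomial growth and integrability. -/

/-- Measurable functions of at most polynomial growth. -/
def PolyGrowth {E : Type*} [NormedAddCommGroup E] [MeasurableSpace E] (f : E → ℝ) : Prop :=
  Measurable f ∧ ∃ (C : ℝ) (N : ℕ), 0 ≤ C ∧ ∀ x, |f x| ≤ C * (1 + ‖x‖) ^ N

namespace PolyGrowth

variable {E : Type*} [NormedAddCommGroup E] [MeasurableSpace E] {f g : E → ℝ}

theorem of_bounded (hf : Measurable f) (C : ℝ) (hC : ∀ x, |f x| ≤ C) : PolyGrowth f :=
  ⟨hf, C, 0, (abs_nonneg _).trans (hC 0), by simpa using hC⟩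

theorem const (c : ℝ) : PolyGrowth (fun _ : E => c) :=
  of_bounded measurable_const |c| fun _ => le_rfl

theorem mul (hf : PolyGrowth f) (hg : PolyGrowth g) : PolyGrowth (fun x => f x * g x) := by
  obtain ⟨mf, C, N, hC, h⟩ := hf
  obtain ⟨mg, D, K, hD, k⟩ := hg
  refine ⟨mf.mul mg, C * D, N + K, by positivity, fun x => ?_⟩
  calc |f x * g x| = |f x| * |g x| := abs_mul _ _
    _ ≤ (C * (1 + ‖x‖) ^ N) * (D * (1 + ‖x‖) ^ K) := by gcongr <;> [exact h x; exact k x]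
    _ = _ := by ring

theorem add (hf : PolyGrowth f) (hg : PolyGrowth g) : PolyGrowth (fun x => f x + g x) := by
  obtain ⟨mf, C, N, hC, h⟩ := hf
  obtain ⟨mg, D, K, hD, k⟩ := hg
  refine ⟨mf.add mg, C + D, N + K, by positivity, fun x => ?_⟩
  have h1 : 1 ≤ 1 + ‖x‖ := by linarith [norm_nonneg x]
  calc |f x + g x| ≤ |f x| + |g x| := abs_add_le _ _
    _ ≤ C * (1 + ‖x‖) ^ N + D * (1 + ‖x‖) ^ K := add_le_add (h x) (k x)
    _ ≤ C * (1 + ‖x‖) ^ (N + K) + D * (1 + ‖x‖) ^ (N + K) := by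
        gcongr <;> first | exact h1 | omega
    _ = _ := by ring

theorem neg (hf : PolyGrowth f) : PolyGrowth (fun x => - f x) := by
  simpa using (const (E := E) (-1)).mul hf

theorem sub (hf : PolyGrowth f) (hg : PolyGrowth g) : PolyGrowth (fun x => f x - g x) := by
  simpa [sub_eq_add_neg] using hf.add hg.neg

theorem pow (hf : PolyGrowth f) (n : ℕ) : PolyGrowth (fun x => f x ^ n) := by
  induction n with
  | zero => simpa using const (E := E) 1
  | succ n ih => simpa [pow_succ] using ih.mul hf

theorem sum {ι : Type*} (s : Finset ι) {f : ι → E → ℝ} (hf : ∀ i, PolyGrowth (f i)) :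
    PolyGrowth (fun x => ∑ i ∈ s, f i x) := by
  classical
  induction s using Finset.induction_on with
  | empty => simpa using const (E := E) 0
  | insert a s ha ih => simpa [Finset.sum_insert ha] using (hf a).add ih

theorem norm [BorelSpace E] : PolyGrowth (fun x : E => ‖x‖) :=
  ⟨measurable_norm, 1, 1, zero_le_one, fun x => by simp⟩

theorem inner_left [InnerProductSpace ℝ E] [BorelSpace E] (y : E) :
    PolyGrowth (fun x : E => (inner ℝ y x : ℝ)) := by
  refine ⟨(continuous_const.inner continuous_id).measurable, ‖y‖, 1, norm_nonneg _, fun x => ?_⟩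
  have := abs_real_inner_le_norm y x
  nlinarith [norm_nonneg y]

theorem comp_clm [NormedSpace ℝ E] [BorelSpace E] {F : Type*} [NormedAddCommGroup F]
    [NormedSpace ℝ F] [MeasurableSpace F] [BorelSpace F] {f : F → ℝ} (hf : PolyGrowth f)
    (L : E →L[ℝ] F) : PolyGrowth (fun x => f (L x)) := by
  obtain ⟨mf, C, N, hC, h⟩ := hf
  refine ⟨mf.comp L.continuous.measurable, C * (1 + ‖L‖) ^ N, N, by positivity, fun x => ?_⟩
  calc |f (L x)| ≤ C * (1 + ‖L x‖) ^ N := h _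
    _ ≤ C * ((1 + ‖L‖) * (1 + ‖x‖)) ^ N := by
        gcongr
        nlinarith [L.le_opNorm x, norm_nonneg L, norm_nonneg x]
    _ = _ := by rw [mul_pow]; ring

/-- A Gaussian measure has moments of all orders. Closure of `PolyGrowth` under algebra then settles
most integrability goals below. -/
theorem integrable [InnerProductSpace ℝ E] [BorelSpace E] [FiniteDimensional ℝ E]
    (hf : PolyGrowth f) : Integrable f (stdGaussian E) := by
  obtain ⟨mf, C, N, hC, h⟩ := hf
  have h1 : MemLp (fun x : E => 1 + ‖x‖) N (stdGaussian E) :=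
    (memLp_const (1 : ℝ)).add (IsGaussian.memLp_id (stdGaussian E) N (by simp)).norm
  have h2 : Integrable (fun x : E => C * (1 + ‖x‖) ^ N) (stdGaussian E) := by
    refine Integrable.const_mul ?_ C
    refine (h1.integrable_norm_pow').congr (ae_of_all _ fun x => ?_)
    simp only [Real.norm_eq_abs]
    rw [abs_of_nonneg (by positivity)]
  exact h2.mono' mf.aestronglyMeasurable (ae_of_all _ h)

end PolyGrowth

/-- Weights `w` for which the radial field `v ↦ w ‖v‖ • v` has at most polynomial growth. -/
def RadialWeight (w : ℝ → ℝ) : Prop :=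
  Measurable w ∧ ∃ (C : ℝ) (N : ℕ), 0 ≤ C ∧ ∀ r, 0 ≤ r → |r * w r| ≤ C * (1 + r) ^ N

namespace RadialWeight

variable {E : Type*} [NormedAddCommGroup E] [MeasurableSpace E] [BorelSpace E] {w : ℝ → ℝ}

theorem polyGrowth_norm_mul (hw : RadialWeight w) :
    PolyGrowth (fun v : E => ‖v‖ * w ‖v‖) := by
  obtain ⟨mw, C, N, hC, h⟩ := hw
  exact ⟨measurable_norm.mul (mw.comp measurable_norm), C, N, hC, fun v => h _ (norm_nonneg v)⟩

variable [InnerProductSpace ℝ E]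

theorem polyGrowth_inner_mul (hw : RadialWeight w) (x : E) :
    PolyGrowth (fun v : E => inner ℝ x v * w ‖v‖) := by
  obtain ⟨mw, C, N, hC, h⟩ := hw
  refine ⟨(continuous_const.inner continuous_id).measurable.mul (mw.comp measurable_norm),
    ‖x‖ * C, N, by positivity, fun v => ?_⟩
  calc |inner ℝ x v * w ‖v‖| ≤ (‖x‖ * ‖v‖) * |w ‖v‖| := by
        rw [abs_mul]; gcongr; exact abs_real_inner_le_norm x v
    _ = ‖x‖ * |‖v‖ * w ‖v‖| := by rw [abs_mul, abs_norm]; ring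
    _ ≤ ‖x‖ * (C * (1 + ‖v‖) ^ N) := by gcongr; exact h _ (norm_nonneg v)
    _ = _ := by ring

theorem polyGrowth_inner_pow_mul (hw : RadialWeight w) (x : E) (k : ℕ) :
    PolyGrowth (fun v : E => inner ℝ x v ^ (k + 1) * w ‖v‖) := by
  simpa only [pow_succ, mul_assoc] using
    ((PolyGrowth.inner_left x).pow k).mul (hw.polyGrowth_inner_mul x)

end RadialWeight

/-! ### Rotation invariance of Gaussian moments with a radial weight. -/

section Isotropy

variable {E : Type*} [NormedAddCommGroup E] [InnerProductSpace ℝ E] [MeasurableSpace E]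
  [BorelSpace E] [FiniteDimensional ℝ E]

/-- The reflection in the hyperplane orthogonal to `x - y` sends `x` to `y` and preserves both the
norm and the Gaussian measure. -/
theorem integral_inner_pow_mul_of_norm_eq (w : ℝ → ℝ) (k : ℕ) {x y : E} (h : ‖x‖ = ‖y‖) :
    ∫ v, inner ℝ x v ^ k * w ‖v‖ ∂(stdGaussian E) = ∫ v, inner ℝ y v ^ k * w ‖v‖ ∂(stdGaussian E) := by
  set e : E ≃ₗᵢ[ℝ] E := (Submodule.span ℝ {x - y})ᗮ.reflection
  have he : e x = y := Submodule.reflection_sub h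
  conv_rhs => rw [← stdGaussian_map e]
  rw [e.toHomeomorph.isClosedEmbedding.measurableEmbedding.integral_map
    (f := e) (g := fun v => inner ℝ y v ^ k * w ‖v‖)]
  refine integral_congr_ae (ae_of_all _ fun v => ?_)
  simp only [LinearIsometryEquiv.norm_map]
  rw [← he, LinearIsometryEquiv.inner_map_map]

theorem integral_inner_pow_mul (w : ℝ → ℝ) (k : ℕ) {e : E} (he : ‖e‖ = 1) (x : E) :
    ∫ v, inner ℝ x v ^ k * w ‖v‖ ∂(stdGaussian E) =
      ‖x‖ ^ k * ∫ v, inner ℝ e v ^ k * w ‖v‖ ∂(stdGaussian E) := by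
  rw [integral_inner_pow_mul_of_norm_eq w k (x := x) (y := ‖x‖ • e) (by simp [norm_smul, he]),
    ← integral_const_mul]
  congr 1 with v
  rw [real_inner_smul_left]; ring

theorem integral_inner_mul_inner_mul {w : ℝ → ℝ} (hw : RadialWeight w) {e : E} (he : ‖e‖ = 1)
    (x z : E) :
    ∫ v, inner ℝ x v * inner ℝ z v * w ‖v‖ ∂(stdGaussian E) =
      inner ℝ x z * ∫ v, inner ℝ e v ^ 2 * w ‖v‖ ∂(stdGaussian E) := by
  have key : ∀ v : E, inner ℝ x v * inner ℝ z v * w ‖v‖ =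
      (1 / 4) * (inner ℝ (x + z) v ^ 2 * w ‖v‖) + (-1 / 4) * (inner ℝ (x - z) v ^ 2 * w ‖v‖) := by
    intro v; rw [inner_add_left, inner_sub_left]; ring
  have hi : ∀ y : E, Integrable (fun v => inner ℝ y v ^ 2 * w ‖v‖) (stdGaussian E) :=
    fun y => (hw.polyGrowth_inner_pow_mul y 1).integrable
  simp_rw [key]
  rw [integral_add ((hi _).const_mul _) ((hi _).const_mul _), integral_const_mul,
    integral_const_mul, integral_inner_pow_mul w 2 he (x + z), integral_inner_pow_mul w 2 he (x - z),
    norm_add_sq_real, norm_sub_sq_real]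
  ring

/-- Polarization writes the integrand through fourth powers of six linear forms, and isotropy
evaluates each. The resulting tensor is that of Isserlis' formula. -/
theorem integral_inner_mul_inner_mul_inner_sq_mul {w : ℝ → ℝ} (hw : RadialWeight w) {e : E}
    (he : ‖e‖ = 1) (x z y : E) :
    ∫ v, inner ℝ x v * inner ℝ z v * inner ℝ y v ^ 2 * w ‖v‖ ∂(stdGaussian E) =
      (inner ℝ x z * ‖y‖ ^ 2 + 2 * inner ℝ x y * inner ℝ z y) / 3 *
        ∫ v, inner ℝ e v ^ 4 * w ‖v‖ ∂(stdGaussian E) := by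
  have key : ∀ v : E, inner ℝ x v * inner ℝ z v * inner ℝ y v ^ 2 * w ‖v‖ =
      (1 / 48) * (inner ℝ (x + z + y) v ^ 4 * w ‖v‖) + (1 / 48) * (inner ℝ (x + z - y) v ^ 4 * w ‖v‖)
      + (-1 / 24) * (inner ℝ (x + z) v ^ 4 * w ‖v‖) + (-1 / 48) * (inner ℝ (x - z + y) v ^ 4 * w ‖v‖)
      + (-1 / 48) * (inner ℝ (x - z - y) v ^ 4 * w ‖v‖)
      + (1 / 24) * (inner ℝ (x - z) v ^ 4 * w ‖v‖) := by
    intro v; simp only [inner_add_left, inner_sub_left]; ring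
  have hi : ∀ (c : ℝ) (y : E),
      Integrable (fun v => c * (inner ℝ y v ^ 4 * w ‖v‖)) (stdGaussian E) :=
    fun c y => (hw.polyGrowth_inner_pow_mul y 3).integrable.const_mul c
  have hn : ∀ a : E, ‖a‖ ^ 4 = (‖a‖ ^ 2) ^ 2 := fun a => by ring
  simp_rw [key]
  rw [integral_add, integral_add, integral_add, integral_add, integral_add]
  · have hJ := integral_inner_pow_mul w 4 he
    generalize ∫ v, inner ℝ e v ^ 4 * w ‖v‖ ∂(stdGaussian E) = J at hJ ⊢
    simp only [integral_const_mul, hJ]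
    simp only [hn, norm_add_sq_real, norm_sub_sq_real, inner_add_left, inner_sub_left]
    ring
  all_goals
    repeat' apply Integrable.add
    all_goals exact hi _ _

/-- Integrability is assumed instead of `RadialWeight` because the lemma is also applied to the
weight `remWeight ^ 2`, which is too singular at 0 to be a `RadialWeight`. -/
theorem integral_inner_sq_mul {w : ℝ → ℝ}
    (hw : ∀ x : E, Integrable (fun v => inner ℝ x v ^ 2 * w ‖v‖) (stdGaussian E))
    {e : E} (he : ‖e‖ = 1) :
    ∫ v, ‖v‖ ^ 2 * w ‖v‖ ∂(stdGaussian E) =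
      Module.finrank ℝ E * ∫ v, inner ℝ e v ^ 2 * w ‖v‖ ∂(stdGaussian E) := by
  have b := stdOrthonormalBasis ℝ E
  simp_rw [← b.sum_sq_inner_right, Finset.sum_mul]
  rw [integral_finsetSum _ fun i _ => hw (b i)]
  simp [integral_inner_pow_mul w 2 he (b _)]

theorem integral_inner_pow_four_mul {w : ℝ → ℝ} (hw : RadialWeight w) {e : E} (he : ‖e‖ = 1) :
    ∫ v, ‖v‖ ^ 4 * w ‖v‖ ∂(stdGaussian E) =
      (Module.finrank ℝ E * (Module.finrank ℝ E + 2)) / 3 *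
        ∫ v, inner ℝ e v ^ 4 * w ‖v‖ ∂(stdGaussian E) := by
  have b := stdOrthonormalBasis ℝ E
  have h4 : ∀ v : E, ‖v‖ ^ 4 * w ‖v‖ =
      ∑ i, ∑ j, inner ℝ (b i) v * inner ℝ (b i) v * inner ℝ (b j) v ^ 2 * w ‖v‖ := by
    intro v
    rw [show ‖v‖ ^ 4 = ‖v‖ ^ 2 * ‖v‖ ^ 2 by ring, ← b.sum_sq_inner_right v, Finset.sum_mul_sum,
      Finset.sum_mul]
    refine Finset.sum_congr rfl fun i _ => ?_
    rw [Finset.sum_mul]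
    refine Finset.sum_congr rfl fun j _ => ?_
    ring
  have hi : ∀ i j, Integrable
      (fun v => inner ℝ (b i) v * inner ℝ (b i) v * inner ℝ (b j) v ^ 2 * w ‖v‖) (stdGaussian E) := by
    intro i j
    have := ((PolyGrowth.inner_left (b i)).mul ((PolyGrowth.inner_left (b j)).pow 2)).mul
      (hw.polyGrowth_inner_mul (b i))
    refine (this.integrable).congr (ae_of_all _ fun v => ?_)
    simp only; ring
  simp_rw [h4]
  rw [integral_finsetSum _ fun i _ => integrable_finsetSum _ fun j _ => hi i j]
  simp_rw [integral_finsetSum _ fun j _ => hi _ j,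
    integral_inner_mul_inner_mul_inner_sq_mul hw he, ← Finset.sum_mul]
  congr 1
  simp only [b.inner_eq_ite, b.norm_eq_one, ← Finset.sum_div]
  congr 1
  simp [Finset.sum_add_distrib]
  ring

end Isotropy

/-! ### Gaussian density and moments of the norm. -/

theorem stdGaussian_eq_withDensity (E : Type*) [NormedAddCommGroup E] [InnerProductSpace ℝ E]
    [FiniteDimensional ℝ E] [MeasurableSpace E] [BorelSpace E] :
    stdGaussian E = volume.withDensity fun v : E => ENNReal.ofReal
      (((2 * Real.pi) ^ (Module.finrank ℝ E / 2 : ℝ))⁻¹ * Real.exp (-(1 / 2) * ‖v‖ ^ 2)) := by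
  have hint : Integrable (fun v : E => Real.exp (-(1 / 2) * ‖v‖ ^ 2)) := by
    have h := GaussianFourier.integral_rexp_neg_mul_sq_norm (V := E) (b := 1 / 2) (by norm_num)
    -- A non-integrable function would have integral 0 by convention, but the Gaussian integral is
    -- positive.
    by_contra hcon
    rw [integral_undef hcon] at h
    exact absurd h.symm (by positivity)
  have : IsFiniteMeasure (volume.withDensity fun v : E => ENNReal.ofReal
      (((2 * Real.pi) ^ (Module.finrank ℝ E / 2 : ℝ))⁻¹ * Real.exp (-(1 / 2) * ‖v‖ ^ 2))) :=
    isFiniteMeasure_withDensity_ofReal (hint.const_mul _).2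
  refine Measure.ext_of_charFun (funext fun t => ?_)
  rw [charFun_stdGaussian, charFun_apply, integral_withDensity_eq_integral_toReal_smul
    (by fun_prop) (by simp)]
  have h := GaussianFourier.integral_cexp_neg_mul_sq_norm_add (V := E) (b := 1 / 2) (by norm_num) Complex.I t
  have e : ∀ v : E, (ENNReal.ofReal (((2 * Real.pi) ^ (Module.finrank ℝ E / 2 : ℝ))⁻¹ *
      Real.exp (-(1 / 2) * ‖v‖ ^ 2))).toReal • Complex.exp ((inner ℝ v t : ℝ) * Complex.I) =
      (((2 * Real.pi) ^ (Module.finrank ℝ E / 2 : ℝ))⁻¹ : ℝ) *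
        Complex.exp (-(1 / 2) * ‖v‖ ^ 2 + Complex.I * (inner ℝ t v : ℝ)) := by
    intro v
    rw [ENNReal.toReal_ofReal (by positivity), Complex.exp_add, real_inner_comm,
      Complex.real_smul]
    push_cast
    ring_nf
  simp_rw [e]
  rw [integral_const_mul, h, show (Real.pi / (1 / 2 : ℂ)) = ((2 * Real.pi : ℝ) : ℂ) by
    push_cast; ring]
  have h2 : ((2 * Real.pi : ℝ) : ℂ) ^ (Module.finrank ℝ E / 2 : ℂ) =
      (((2 * Real.pi) ^ (Module.finrank ℝ E / 2 : ℝ) : ℝ) : ℂ) := by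
    rw [Complex.ofReal_cpow (by positivity)]; push_cast; rfl
  rw [h2, ← mul_assoc, ← Complex.ofReal_mul, inv_mul_cancel₀ (by positivity)]
  simp only [Complex.ofReal_one, one_mul, Complex.I_sq]
  congr 1; ring

/-- Moments of the norm of a standard Gaussian vector. -/
theorem integral_norm_pow_stdGaussian (E : Type*) [NormedAddCommGroup E] [InnerProductSpace ℝ E]
    [FiniteDimensional ℝ E] [MeasurableSpace E] [BorelSpace E] [Nontrivial E] (k : ℕ) :
    ∫ v, ‖v‖ ^ k ∂(stdGaussian E) = (2 : ℝ) ^ (k / 2 : ℝ) *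
      Real.Gamma ((Module.finrank ℝ E + k) / 2) / Real.Gamma (Module.finrank ℝ E / 2) := by
  set d := Module.finrank ℝ E with hd
  have hd0 : 0 < d := Module.finrank_pos
  -- Polar coordinates give all moments up to one constant independent of `k`. Total mass one, the
  -- case `k = 0`, determines it, so the volume of the unit ball is never computed.
  have main : ∃ K : ℝ, ∀ k : ℕ, ∫ v, ‖v‖ ^ k ∂(stdGaussian E) =
      K * ((2 : ℝ) ^ ((d + k) / 2 : ℝ) * Real.Gamma ((d + k) / 2)) := by
    refine ⟨((2 * Real.pi) ^ (d / 2 : ℝ))⁻¹ * (d * (volume : Measure E).real (Metric.ball 0 1)) / 2,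
      fun k => ?_⟩
    rw [stdGaussian_eq_withDensity E, integral_withDensity_eq_integral_toReal_smul
      (by fun_prop) (by simp)]
    have e : ∀ v : E, (ENNReal.ofReal (((2 * Real.pi) ^ (d / 2 : ℝ))⁻¹ *
        Real.exp (-(1 / 2) * ‖v‖ ^ 2))).toReal • ‖v‖ ^ k =
        ((2 * Real.pi) ^ (d / 2 : ℝ))⁻¹ * (fun r : ℝ => Real.exp (-(1 / 2) * r ^ 2) * r ^ k) ‖v‖ := by
      intro v
      rw [ENNReal.toReal_ofReal (by positivity), smul_eq_mul, mul_assoc]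
    simp only [← hd, e]
    rw [integral_const_mul, integral_fun_norm_addHaar volume
      (fun r : ℝ => Real.exp (-(1 / 2) * r ^ 2) * r ^ k), ← hd]
    have h := integral_rpow_mul_exp_neg_mul_rpow (p := 2) (q := (d - 1 : ℝ) + k) (b := 1 / 2)
      (by norm_num) (by have : (1 : ℝ) ≤ d := by exact_mod_cast hd0
                        have : (0 : ℝ) ≤ k := by positivity
                        linarith) (by norm_num)
    have e2 : ∫ y in Set.Ioi (0 : ℝ), y ^ (d - 1) • (Real.exp (-(1 / 2) * y ^ 2) * y ^ k) =
        ∫ x in Set.Ioi (0 : ℝ), x ^ ((d - 1 : ℝ) + k) * Real.exp (-(1 / 2) * x ^ (2 : ℝ)) := by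
      refine setIntegral_congr_fun measurableSet_Ioi fun y hy => ?_
      have hy : 0 < y := hy
      simp only [smul_eq_mul]
      rw [show ((d - 1 : ℝ) + k) = ((d - 1 + k : ℕ) : ℝ) by push_cast [Nat.cast_sub hd0]; ring,
        Real.rpow_natCast, pow_add, Real.rpow_two]
      ring
    rw [e2, h, show ((d - 1 : ℝ) + k + 1) = d + k by ring, one_div, Real.inv_rpow (by norm_num),
      ← Real.rpow_neg (zero_le_two (α := ℝ)), show -(-(d + k : ℝ) / 2) = (d + k) / 2 by ring]
    simp only [nsmul_eq_mul, smul_eq_mul]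
    ring
  obtain ⟨K, hK⟩ := main
  have h0 := hK 0
  have hG : 0 < Real.Gamma (d / 2 : ℝ) := Real.Gamma_pos_of_pos (by positivity)
  have h2 : 0 < (2 : ℝ) ^ (d / 2 : ℝ) := by positivity
  simp only [pow_zero, integral_const, probReal_univ, smul_eq_mul, mul_one, Nat.cast_zero,
    add_zero] at h0
  rw [hK k, add_div, Real.rpow_add (by norm_num)]
  have : K = ((2 : ℝ) ^ (d / 2 : ℝ) * Real.Gamma (d / 2))⁻¹ := by
    field_simp; linarith
  rw [this]; field_simp

abbrev Space3 : Type := EuclideanSpace ℝ (Fin 3)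

theorem Gamma_three_halves : Real.Gamma (3 / 2) = Real.sqrt Real.pi / 2 := by
  rw [show (3 / 2 : ℝ) = 1 / 2 + 1 by norm_num, Real.Gamma_add_one (by norm_num),
    Real.Gamma_one_half_eq]; ring

theorem integral_norm_pow_two_mul (k : ℕ) : ∫ v, ‖v‖ ^ (2 * k) ∂(stdGaussian Space3) =
    (2 : ℝ) ^ k * Real.Gamma (3 / 2 + k) / Real.Gamma (3 / 2) := by
  rw [integral_norm_pow_stdGaussian]
  simp only [finrank_euclideanSpace, Fintype.card_fin]
  rw [show (((2 * k : ℕ) : ℝ) / 2) = k by push_cast; ring, Real.rpow_natCast]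
  rw [show (((3 : ℕ) + (2 * k : ℕ) : ℝ) / 2) = 3 / 2 + k by push_cast; ring, Nat.cast_ofNat]

theorem integral_norm_sq_stdGaussian : ∫ v, ‖v‖ ^ 2 ∂(stdGaussian Space3) = 3 := by
  have h : Real.Gamma (3 / 2) ≠ 0 := (Real.Gamma_pos_of_pos (by norm_num)).ne'
  refine (integral_norm_pow_two_mul 1).trans ?_
  rw [ Nat.cast_one,
    Real.Gamma_add_one (by norm_num)]
  field_simp

theorem integral_norm_pow_four_stdGaussian : ∫ v, ‖v‖ ^ 4 ∂(stdGaussian Space3) = 15 := by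
  have h : Real.Gamma (3 / 2) ≠ 0 := (Real.Gamma_pos_of_pos (by norm_num)).ne'
  refine (integral_norm_pow_two_mul 2).trans ?_
  rw [
    show (3 / 2 + (2 : ℕ) : ℝ) = 3 / 2 + 1 + 1 by norm_num,
    Real.Gamma_add_one (by norm_num), Real.Gamma_add_one (by norm_num)]
  field_simp; norm_num

theorem integral_norm_pow_six_stdGaussian : ∫ v, ‖v‖ ^ 6 ∂(stdGaussian Space3) = 105 := by
  have h : Real.Gamma (3 / 2) ≠ 0 := (Real.Gamma_pos_of_pos (by norm_num)).ne'
  refine (integral_norm_pow_two_mul 3).trans ?_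
  rw [
    show (3 / 2 + (3 : ℕ) : ℝ) = 3 / 2 + 1 + 1 + 1 by norm_num,
    Real.Gamma_add_one (by norm_num), Real.Gamma_add_one (by norm_num),
    Real.Gamma_add_one (by norm_num)]
  field_simp; norm_num

/-- The coefficient of the linear Hermite term of `v ↦ ‖v‖⁻¹ • v`. -/
def linCoeff : ℝ := Real.sqrt (8 / (9 * Real.pi))

theorem linCoeff_sq : linCoeff ^ 2 = 8 / (9 * Real.pi) := Real.sq_sqrt (by positivity)

theorem integral_norm_stdGaussian : ∫ v, ‖v‖ ∂(stdGaussian Space3) = 3 * linCoeff := by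
  have h := integral_norm_pow_stdGaussian Space3 1
  simp only [finrank_euclideanSpace, Fintype.card_fin, pow_one, Nat.cast_one, Nat.cast_ofNat] at h
  rw [h, ← Real.sqrt_eq_rpow, show ((3 + 1) / 2 : ℝ) = 2 by norm_num, Real.Gamma_two,
    Gamma_three_halves, linCoeff, show (8 / (9 * Real.pi) : ℝ) = 2 * (2 / 3) ^ 2 / Real.pi by
      field_simp; norm_num, Real.sqrt_div (by norm_num), Real.sqrt_mul (by norm_num),
    Real.sqrt_sq (by norm_num)]
  field_simp

theorem integral_norm_pow_three_stdGaussian :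
    ∫ v, ‖v‖ ^ 3 ∂(stdGaussian Space3) = 12 * linCoeff := by
  have h1 := integral_norm_pow_stdGaussian Space3 1
  have h := integral_norm_pow_stdGaussian Space3 3
  simp only [pow_one] at h1
  rw [integral_norm_stdGaussian] at h1
  simp only [finrank_euclideanSpace, Fintype.card_fin, Nat.cast_one, Nat.cast_ofNat] at h h1
  rw [show ((3 + 3) / 2 : ℝ) = 2 + 1 by norm_num, Real.Gamma_add_one (by norm_num),
    show (3 / 2 : ℝ) = 1 / 2 + 1 by norm_num, Real.rpow_add (by norm_num), Real.rpow_one] at h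
  rw [show ((3 + 1) / 2 : ℝ) = 2 by norm_num, show (3 / 2 : ℝ) = 1 / 2 + 1 by norm_num] at h1
  rw [h, show 12 * linCoeff = 4 * (3 * linCoeff) by ring, h1]
  ring

/-! ### Coordinates along orthonormal families and independence of orthogonal parts. -/

section CoordMap

variable {E : Type*} [NormedAddCommGroup E] [InnerProductSpace ℝ E] {ι κ : Type*}

/-- The vector of inner products with a finite family. -/
def coordMap (y : ι → E) : E →L[ℝ] EuclideanSpace ℝ ι :=
  (EuclideanSpace.equiv ι ℝ).symm.toContinuousLinearMap ∘L
    ContinuousLinearMap.pi fun i => innerSL ℝ (y i)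

@[simp] theorem coordMap_apply (y : ι → E) (r : E) (i : ι) : coordMap y r i = inner ℝ (y i) r := rfl

theorem coordMap_eq_zero_of_orthogonal {y : ι → E} {z : E} (h : ∀ i, inner ℝ (y i) z = 0) :
    coordMap y z = 0 := by
  ext i; simp [h]

variable [Fintype ι] [Fintype κ]

theorem inner_coordMap (y : ι → E) (p : EuclideanSpace ℝ ι) (r : E) :
    inner ℝ p (coordMap y r) = inner ℝ (∑ i, p i • y i) r := by
  simp [PiLp.inner_apply, sum_inner, real_inner_smul_left, mul_comm]

/-- The component of `x` orthogonal to an orthonormal family. -/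
def orthPart (y : ι → E) (x : E) : E := x - ∑ i, inner ℝ (y i) x • y i

theorem inner_eq_inner_coordMap_add (y : ι → E) (x r : E) :
    inner ℝ x r = inner ℝ (coordMap y x) (coordMap y r) + inner ℝ (orthPart y x) r := by
  rw [inner_coordMap, orthPart, inner_sub_left]
  simp

theorem inner_orthPart_right {y : ι → E} (hy : Orthonormal ℝ y) (x : E) (i : ι) :
    inner ℝ (y i) (orthPart y x) = 0 := by
  classical
  simp [orthPart, inner_sub_right, inner_sum, real_inner_smul_right,
    orthonormal_iff_ite.mp hy]

theorem inner_orthPart_orthPart {y : ι → E} (hy : Orthonormal ℝ y) (x z : E) :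
    inner ℝ (orthPart y x) (orthPart y z) =
      inner ℝ x z - inner ℝ (coordMap y x) (coordMap y z) := by
  have h := inner_eq_inner_coordMap_add y x (orthPart y z)
  rw [coordMap_eq_zero_of_orthogonal (inner_orthPart_right hy z), inner_zero_right, zero_add] at h
  have h' := inner_eq_inner_coordMap_add y z x
  rw [real_inner_comm x z, real_inner_comm (coordMap y x)] at h'
  rw [← h, h', real_inner_comm x]
  ring

variable [MeasurableSpace E] [BorelSpace E] [FiniteDimensional ℝ E]

theorem map_coordMap_stdGaussian {y : ι → E} (hy : Orthonormal ℝ y) :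
    (stdGaussian E).map (coordMap y) = stdGaussian (EuclideanSpace ℝ ι) := by
  refine Measure.ext_of_charFun (funext fun t => ?_)
  have h : ∀ r, inner ℝ (coordMap y r) t = inner ℝ r (∑ i, t i • y i) := fun r => by
    rw [real_inner_comm, inner_coordMap, real_inner_comm]
  rw [charFun_apply, integral_map (coordMap y).continuous.aemeasurable (by fun_prop)]
  simp_rw [h]
  rw [← charFun_apply, charFun_stdGaussian, charFun_stdGaussian]
  rw [← Complex.ofReal_pow, ← Complex.ofReal_pow, ← real_inner_self_eq_norm_sq,
    hy.inner_sum, EuclideanSpace.real_norm_sq_eq]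
  simp [pow_two]

theorem integral_comp_coordMap {y : ι → E} (hy : Orthonormal ℝ y)
    {φ : EuclideanSpace ℝ ι → ℝ} (hφ : PolyGrowth φ) :
    ∫ r, φ (coordMap y r) ∂(stdGaussian E) = ∫ v, φ v ∂(stdGaussian (EuclideanSpace ℝ ι)) := by
  rw [← map_coordMap_stdGaussian hy, integral_map (coordMap y).continuous.aemeasurable
    hφ.1.aestronglyMeasurable]

theorem covariance_inner_stdGaussian (x z : E) :
    cov[fun r => inner ℝ x r, fun r => inner ℝ z r; stdGaussian E] = inner ℝ x z := by
  rw [← covarianceBilin_apply_eq_cov IsGaussian.memLp_two_id, covarianceBilin_stdGaussian]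
  rfl

theorem integral_inner_mul_inner (x z : E) :
    ∫ r, inner ℝ x r * inner ℝ z r ∂(stdGaussian E) = inner ℝ x z := by
  have h := covariance_inner_stdGaussian x z
  rw [covariance_eq_sub] at h
  · have h0 : ∫ r, inner ℝ z r ∂(stdGaussian E) = 0 :=
      integral_strongDual_stdGaussian (innerSL ℝ z)
    rw [h0, mul_zero, sub_zero] at h
    exact h
  · exact IsGaussian.memLp_dual _ (innerSL ℝ x) 2 (by simp)
  · exact IsGaussian.memLp_dual _ (innerSL ℝ z) 2 (by simp)

/-- The two coordinate vectors are jointly Gaussian and uncorrelated. -/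
theorem indepFun_coordMap {z : κ → E} {y : ι → E} (h : ∀ i j, inner ℝ (z i) (y j) = 0) :
    IndepFun (coordMap z) (coordMap y) (stdGaussian E) := by
  refine HasGaussianLaw.indepFun_of_covariance_inner
    ((IsGaussian.hasGaussianLaw_id (μ := stdGaussian E)).map_fun
      ((coordMap z).prod (coordMap y))) fun p q => ?_
  simp_rw [inner_coordMap]
  rw [covariance_inner_stdGaussian]
  simp [sum_inner, inner_sum, real_inner_smul_left, real_inner_smul_right, h]

theorem integral_odd_stdGaussian {f : E → ℝ} (hf : ∀ r, f (-r) = - f r) :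
    ∫ r, f r ∂(stdGaussian E) = 0 := by
  have h : ∫ r, f r ∂(stdGaussian E) = ∫ r, f (-r) ∂(stdGaussian E) := by
    conv_lhs => rw [← stdGaussian_map (LinearIsometryEquiv.neg ℝ (E := E))]
    rw [(LinearIsometryEquiv.neg ℝ (E := E)).toHomeomorph.isClosedEmbedding.measurableEmbedding.integral_map
      (f := (LinearIsometryEquiv.neg ℝ (E := E)))]
    rfl
  simp_rw [hf] at h
  rw [integral_neg] at h
  linarith

/-- Conditional moments given the coordinates `coordMap y`, for the orthogonal part. -/
theorem integral_orthogonal_mul {z : κ → E} {y : ι → E}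
    (h : ∀ i j, inner ℝ (z i) (y j) = 0) {ψ : EuclideanSpace ℝ κ → ℝ} (hψ : PolyGrowth ψ)
    {φ : EuclideanSpace ℝ ι → ℝ} (hφ : PolyGrowth φ) :
    ∫ r, ψ (coordMap z r) * φ (coordMap y r) ∂(stdGaussian E) =
      (∫ r, ψ (coordMap z r) ∂(stdGaussian E)) * ∫ r, φ (coordMap y r) ∂(stdGaussian E) :=
  (indepFun_coordMap h).integral_fun_comp_mul_comp (coordMap z).continuous.aemeasurable
    (coordMap y).continuous.aemeasurable hψ.1.aestronglyMeasurable hφ.1.aestronglyMeasurable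

end CoordMap

/-! ### Moments of forms in one triple against functions of another. -/

section CrossMoments

variable {E : Type*} [NormedAddCommGroup E] [InnerProductSpace ℝ E] {ι : Type*} [Fintype ι]
  [MeasurableSpace E] [BorelSpace E] [FiniteDimensional ℝ E]

theorem polyGrowth_coord {κ : Type*} [Fintype κ] (i : κ) :
    PolyGrowth fun v : EuclideanSpace ℝ κ => v i := by
  classical
  have h := PolyGrowth.inner_left (EuclideanSpace.single i (1 : ℝ))
  simp only [EuclideanSpace.inner_single_left, map_one, one_mul] at h
  exact h

/-- The part of `x` orthogonal to the family `y` gives a centred variable independent of `coordMap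
y`, so only the projection of `x` survives. -/
theorem integral_inner_mul_comp_coordMap {y : ι → E} (hy : Orthonormal ℝ y) (x : E)
    {φ : EuclideanSpace ℝ ι → ℝ} (hφ : PolyGrowth φ) :
    ∫ r, inner ℝ x r * φ (coordMap y r) ∂(stdGaussian E) =
      ∫ v, inner ℝ (coordMap y x) v * φ v ∂(stdGaussian (EuclideanSpace ℝ ι)) := by
  have ho : ∀ i : Fin 1, ∀ j, inner ℝ ((fun _ : Fin 1 => orthPart y x) i) (y j) = 0 :=
    fun _ j => by rw [real_inner_comm]; exact inner_orthPart_right hy x j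
  have h0 := integral_orthogonal_mul ho (polyGrowth_coord 0) hφ
  simp only [coordMap_apply] at h0
  rw [integral_odd_stdGaussian (f := fun r => inner ℝ (orthPart y x) r) (by simp), zero_mul] at h0
  have g1 := (PolyGrowth.inner_left (coordMap y x)).mul hφ
  simp_rw [inner_eq_inner_coordMap_add y x, add_mul]
  rw [integral_add, h0, add_zero, integral_comp_coordMap hy g1]
  · exact (g1.comp_clm (coordMap y)).integrable
  · exact ((PolyGrowth.inner_left (orthPart y x)).mul (hφ.comp_clm (coordMap y))).integrable

/-- Split `x` into `a` and `p`, and `z` into `c` and `q`, where `p`, `q` are orthogonal to the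
family, and expand `(a + p)(c + q)²`. Terms odd in `(p, q)` vanish; `q²` and `pq` contribute the
inner products of the orthogonal parts, which are the two bracketed differences. -/
theorem integral_inner_mul_inner_sq_mul_comp_coordMap {y : ι → E} (hy : Orthonormal ℝ y) (x z : E)
    {φ : EuclideanSpace ℝ ι → ℝ} (hφ : PolyGrowth φ) :
    ∫ r, inner ℝ x r * inner ℝ z r ^ 2 * φ (coordMap y r) ∂(stdGaussian E) =
      ∫ v, inner ℝ (coordMap y x) v * inner ℝ (coordMap y z) v ^ 2 * φ v
          ∂(stdGaussian (EuclideanSpace ℝ ι)) +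
      (‖z‖ ^ 2 - ‖coordMap y z‖ ^ 2) *
        ∫ v, inner ℝ (coordMap y x) v * φ v ∂(stdGaussian (EuclideanSpace ℝ ι)) +
      2 * (inner ℝ x z - inner ℝ (coordMap y x) (coordMap y z)) *
        ∫ v, inner ℝ (coordMap y z) v * φ v ∂(stdGaussian (EuclideanSpace ℝ ι)) := by
  set a := coordMap y x with ha
  set c := coordMap y z with hc
  set p := orthPart y x with hp
  set q := orthPart y z with hq
  have ho : ∀ i : Fin 2, ∀ j, inner ℝ (![p, q] i) (y j) = 0 := by
    intro i j
    rw [real_inner_comm]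
    fin_cases i
    · exact inner_orthPart_right hy x j
    · exact inner_orthPart_right hy z j
  have ga : PolyGrowth fun v => inner ℝ a v := PolyGrowth.inner_left a
  have gc : PolyGrowth fun v => inner ℝ c v := PolyGrowth.inner_left c
  have g0 := polyGrowth_coord (0 : Fin 2)
  have g1 := polyGrowth_coord (1 : Fin 2)
  have e1 := integral_orthogonal_mul ho g0 ((gc.pow 2).mul hφ)
  have e2 := integral_orthogonal_mul ho g1 ((ga.mul gc).mul hφ)
  have e3 := integral_orthogonal_mul ho (g1.pow 2) (ga.mul hφ)
  have e4 := integral_orthogonal_mul ho (g0.mul g1) (gc.mul hφ)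
  have e5 := integral_orthogonal_mul ho (g0.mul (g1.pow 2)) hφ
  simp only [coordMap_apply, Matrix.cons_val_zero, Matrix.cons_val_one] at e1 e2 e3 e4 e5
  rw [integral_odd_stdGaussian (f := fun r => inner ℝ p r) (by simp), zero_mul] at e1
  rw [integral_odd_stdGaussian (f := fun r => inner ℝ q r) (by simp), zero_mul] at e2
  rw [integral_odd_stdGaussian (f := fun r => inner ℝ p r * inner ℝ q r ^ 2) (by simp),
    zero_mul] at e5
  simp only [pow_two (inner ℝ q _)] at e3
  rw [integral_inner_mul_inner, hq, inner_orthPart_orthPart hy, integral_comp_coordMap hy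
    (ga.mul hφ), ← hc, ← hq] at e3
  rw [integral_inner_mul_inner, hp, hq, inner_orthPart_orthPart hy, integral_comp_coordMap hy
    (gc.mul hφ), ← hc, ← ha, ← hp, ← hq] at e4
  have key : ∀ r : E, inner ℝ x r * inner ℝ z r ^ 2 * φ (coordMap y r) =
      inner ℝ a (coordMap y r) * inner ℝ c (coordMap y r) ^ 2 * φ (coordMap y r)
      + inner ℝ p r * (inner ℝ c (coordMap y r) ^ 2 * φ (coordMap y r))
      + 2 * (inner ℝ q r * (inner ℝ a (coordMap y r) * inner ℝ c (coordMap y r) * φ (coordMap y r)))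
      + inner ℝ q r * inner ℝ q r * (inner ℝ a (coordMap y r) * φ (coordMap y r))
      + 2 * (inner ℝ p r * inner ℝ q r * (inner ℝ c (coordMap y r) * φ (coordMap y r)))
      + inner ℝ p r * inner ℝ q r ^ 2 * φ (coordMap y r) := by
    intro r
    rw [inner_eq_inner_coordMap_add y x r, inner_eq_inner_coordMap_add y z r]
    ring
  have gp : PolyGrowth fun r : E => inner ℝ p r := PolyGrowth.inner_left p
  have gq : PolyGrowth fun r : E => inner ℝ q r := PolyGrowth.inner_left q
  have ga' := ga.comp_clm (coordMap y)
  have gc' := gc.comp_clm (coordMap y)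
  have gφ' := hφ.comp_clm (coordMap y)
  have i0 := (ga'.mul (gc'.pow 2)).mul gφ'
  have i1 := gp.mul ((gc'.pow 2).mul gφ')
  have i2 := (PolyGrowth.const 2).mul (gq.mul ((ga'.mul gc').mul gφ'))
  have i3 := (gq.mul gq).mul (ga'.mul gφ')
  have i4 := (PolyGrowth.const 2).mul ((gp.mul gq).mul (gc'.mul gφ'))
  have i5 := (gp.mul (gq.pow 2)).mul gφ'
  have j1 := i0.add i1
  have j2 := j1.add i2
  have j3 := j2.add i3
  have j4 := j3.add i4
  simp_rw [key]
  rw [integral_add j4.integrable i5.integrable, integral_add j3.integrable i4.integrable,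
    integral_add j2.integrable i3.integrable, integral_add j1.integrable i2.integrable,
    integral_add i0.integrable i1.integrable, e1, integral_const_mul, e2, e3,
    integral_const_mul, e4, e5, integral_comp_coordMap hy ((ga.mul (gc.pow 2)).mul hφ),
    real_inner_self_eq_norm_sq, real_inner_self_eq_norm_sq]
  ring

end CrossMoments

/-! ### Linear and cubic Hermite fields against radial fields. -/

section RadialFields

variable {E : Type*} [NormedAddCommGroup E] [InnerProductSpace ℝ E]
  [MeasurableSpace E] [BorelSpace E] [FiniteDimensional ℝ E]

/-- The matrix of inner products of two families. -/
def crossGram (x y : Fin 3 → E) : Matrix (Fin 3) (Fin 3) ℝ := Matrix.of fun a b => inner ℝ (x a) (y b)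

/-- The cubic form `‖T‖² T + 2 T Tᵀ T`. -/
def cubicForm (T : Matrix (Fin 3) (Fin 3) ℝ) : Matrix (Fin 3) (Fin 3) ℝ :=
  (∑ a, ∑ b, T a b ^ 2) • T + (2 : ℝ) • (T * T.transpose * T)

theorem RadialWeight.polyGrowth_coord_mul {w : ℝ → ℝ} (hw : RadialWeight w) (b : Fin 3) :
    PolyGrowth fun v : Space3 => v b * w ‖v‖ := by
  have h := hw.polyGrowth_inner_mul (EuclideanSpace.single b (1 : ℝ))
  simp only [EuclideanSpace.inner_single_left, map_one, one_mul] at h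
  exact h

theorem integral_inner_mul_coord_mul {w : ℝ → ℝ} (hw : RadialWeight w) (t : Space3) (b : Fin 3) :
    ∫ v : Space3, inner ℝ t v * (v b * w ‖v‖) ∂(stdGaussian Space3) =
      t b * ((∫ v : Space3, ‖v‖ ^ 2 * w ‖v‖ ∂(stdGaussian Space3)) / 3) := by
  have he : ‖(EuclideanSpace.single b (1 : ℝ) : Space3)‖ = 1 := by simp
  have h := integral_inner_mul_inner_mul hw he t (EuclideanSpace.single b 1)
  rw [integral_inner_sq_mul (fun x => (hw.polyGrowth_inner_pow_mul x 1).integrable) he]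
  simp only [EuclideanSpace.inner_single_left, EuclideanSpace.inner_single_right, map_one, one_mul,
    conj_trivial, mul_assoc] at h ⊢
  rw [h]
  simp

theorem integral_inner_mul_inner_sq_mul_coord_mul {w : ℝ → ℝ} (hw : RadialWeight w) (t s : Space3)
    (b : Fin 3) :
    ∫ v : Space3, inner ℝ t v * inner ℝ s v ^ 2 * (v b * w ‖v‖) ∂(stdGaussian Space3) =
      (t b * ‖s‖ ^ 2 + 2 * inner ℝ t s * s b) *
        ((∫ v : Space3, ‖v‖ ^ 4 * w ‖v‖ ∂(stdGaussian Space3)) / 15) := by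
  have he : ‖(EuclideanSpace.single b (1 : ℝ) : Space3)‖ = 1 := by simp
  have h := integral_inner_mul_inner_mul_inner_sq_mul hw he t (EuclideanSpace.single b 1) s
  rw [integral_inner_pow_four_mul hw he]
  simp only [EuclideanSpace.inner_single_left, EuclideanSpace.inner_single_right, map_one, one_mul,
    conj_trivial] at h ⊢
  have e : ∀ v : Space3, inner ℝ t v * inner ℝ s v ^ 2 * (v b * w ‖v‖) =
    inner ℝ t v * v b * inner ℝ s v ^ 2 * w ‖v‖ := fun v => by ring
  simp_rw [e]
  rw [h]
  simp only [finrank_euclideanSpace, Fintype.card_fin, Nat.cast_ofNat]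
  ring

variable {x y : Fin 3 → E}

theorem integral_linear_mul_radial {w : ℝ → ℝ} (hw : RadialWeight w) (hy : Orthonormal ℝ y)
    (a b : Fin 3) :
    ∫ r, coordMap x r a * (coordMap y r b * w ‖coordMap y r‖) ∂(stdGaussian E) =
      crossGram x y a b * ((∫ v : Space3, ‖v‖ ^ 2 * w ‖v‖ ∂(stdGaussian Space3)) / 3) := by
  have h := integral_inner_mul_comp_coordMap hy (x a) (hw.polyGrowth_coord_mul b)
  rw [integral_inner_mul_coord_mul hw, coordMap_apply, real_inner_comm] at h
  exact h

/-- Summing the cross moments of `x a` with `(x c)²` over `c` produces linear terms `3T + 2T`; the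
constant 5 of the Hermite polynomial removes exactly these and leaves only the cubic form of `T`. -/
theorem integral_cubic_mul_radial {w : ℝ → ℝ} (hw : RadialWeight w) (hx : Orthonormal ℝ x)
    (hy : Orthonormal ℝ y) (a b : Fin 3) :
    ∫ r, coordMap x r a * (‖coordMap x r‖ ^ 2 - 5) *
        (coordMap y r b * w ‖coordMap y r‖) ∂(stdGaussian E) =
      ((∫ v : Space3, ‖v‖ ^ 4 * w ‖v‖ ∂(stdGaussian Space3)) / 15 -
        (∫ v : Space3, ‖v‖ ^ 2 * w ‖v‖ ∂(stdGaussian Space3)) / 3) *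
        cubicForm (crossGram x y) a b := by
  have gφ := hw.polyGrowth_coord_mul b
  have gφ' := gφ.comp_clm (coordMap y)
  have e : ∀ r, coordMap x r a * (‖coordMap x r‖ ^ 2 - 5) *
      (coordMap y r b * w ‖coordMap y r‖) =
      ∑ c, inner ℝ (x a) r * inner ℝ (x c) r ^ 2 * (coordMap y r b * w ‖coordMap y r‖) -
      5 * (coordMap x r a * (coordMap y r b * w ‖coordMap y r‖)) := by
    intro r
    rw [EuclideanSpace.real_norm_sq_eq, ← Finset.sum_mul, ← Finset.mul_sum]
    simp only [coordMap_apply]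
    ring
  have i1 : ∀ c, Integrable (fun r => inner ℝ (x a) r * inner ℝ (x c) r ^ 2 *
      (coordMap y r b * w ‖coordMap y r‖)) (stdGaussian E) := fun c =>
    (((PolyGrowth.inner_left (x a)).mul ((PolyGrowth.inner_left (x c)).pow 2)).mul gφ').integrable
  have i2 : Integrable (fun r => coordMap x r a * (coordMap y r b * w ‖coordMap y r‖))
      (stdGaussian E) := ((PolyGrowth.inner_left (x a)).mul gφ').integrable
  simp_rw [e]
  rw [integral_sub (integrable_finsetSum _ fun c _ => i1 c) (i2.const_mul 5), integral_const_mul,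
    integral_linear_mul_radial hw hy, integral_finsetSum _ fun c _ => i1 c]
  have hc : ∀ c, ∫ r, inner ℝ (x a) r * inner ℝ (x c) r ^ 2 *
      (coordMap y r b * w ‖coordMap y r‖) ∂(stdGaussian E) = _ := fun c =>
    integral_inner_mul_inner_sq_mul_comp_coordMap hy (x a) (x c) gφ
  simp_rw [hc, integral_inner_mul_inner_sq_mul_coord_mul hw, integral_inner_mul_coord_mul hw]
  generalize (∫ v : Space3, ‖v‖ ^ 4 * w ‖v‖ ∂(stdGaussian Space3)) / 15 = K4
  generalize (∫ v : Space3, ‖v‖ ^ 2 * w ‖v‖ ∂(stdGaussian Space3)) / 3 = K2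
  have ht : ∀ c d, coordMap y (x c) d = crossGram x y c d := fun c d => by
    rw [coordMap_apply, real_inner_comm]; rfl
  generalize hT : crossGram x y = T at ht ⊢
  have hxx : ∀ c, inner ℝ (x a) (x c) = if a = c then (1 : ℝ) else 0 := fun c =>
    orthonormal_iff_ite.mp hx a c
  simp only [hx.1, EuclideanSpace.real_norm_sq_eq, PiLp.inner_apply, ht, hxx, RCLike.inner_apply,
    conj_trivial, cubicForm, Matrix.add_apply, Matrix.smul_apply, Matrix.mul_apply,
    Matrix.transpose_apply, smul_eq_mul, Fin.sum_univ_three]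
  fin_cases a <;> simp <;> ring

end RadialFields

/-! ### The cubic Hermite truncation of `v/‖v‖` and its remainder. -/

section Weights

/-- The truncation of `r ↦ r⁻¹` whose radial field is the cubic Hermite truncation. -/
def polyWeight (r : ℝ) : ℝ := linCoeff - linCoeff / 10 * (r ^ 2 - 5)

/-- The remainder of the truncation. -/
def remWeight (r : ℝ) : ℝ := r⁻¹ - polyWeight r

theorem linCoeff_nonneg : 0 ≤ linCoeff := Real.sqrt_nonneg _

theorem radialWeight_inv : RadialWeight fun r => r⁻¹ := by
  refine ⟨measurable_inv, 1, 0, zero_le_one, fun r _ => ?_⟩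
  rcases eq_or_ne r 0 with h | h <;> simp [h]

theorem radialWeight_polyWeight : RadialWeight polyWeight := by
  refine ⟨by unfold polyWeight; fun_prop, 2 * linCoeff, 3,
    by have := linCoeff_nonneg; positivity, fun r hr => ?_⟩
  have hA := linCoeff_nonneg
  rw [abs_le]
  unfold polyWeight
  constructor <;> nlinarith [mul_nonneg hA hr, mul_nonneg hA (pow_nonneg hr 2),
    mul_nonneg hA (pow_nonneg hr 3)]

theorem RadialWeight.sub {w u : ℝ → ℝ} (hw : RadialWeight w) (hu : RadialWeight u) :
    RadialWeight fun r => w r - u r := by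
  obtain ⟨mw, C, N, hC, h⟩ := hw
  obtain ⟨mu, D, K, hD, k⟩ := hu
  refine ⟨mw.sub mu, C + D, N + K, by positivity, fun r hr => ?_⟩
  have h1 : 1 ≤ 1 + r := by linarith
  calc |r * (w r - u r)| = |r * w r - r * u r| := by ring_nf
    _ ≤ |r * w r| + |r * u r| := abs_sub _ _
    _ ≤ C * (1 + r) ^ N + D * (1 + r) ^ K := add_le_add (h r hr) (k r hr)
    _ ≤ C * (1 + r) ^ (N + K) + D * (1 + r) ^ (N + K) := by
        gcongr <;> first | exact h1 | omega
    _ = _ := by ring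

theorem radialWeight_remWeight : RadialWeight remWeight :=
  radialWeight_inv.sub radialWeight_polyWeight

theorem integrable_norm_pow (k : ℕ) : Integrable (fun v : Space3 => ‖v‖ ^ k) (stdGaussian Space3) :=
  (PolyGrowth.norm.pow k).integrable

theorem integral_norm_sq_mul_inv :
    ∫ v : Space3, ‖v‖ ^ 2 * ‖v‖⁻¹ ∂(stdGaussian Space3) = 3 * linCoeff := by
  rw [← integral_norm_stdGaussian]
  congr 1 with v
  rcases eq_or_ne ‖v‖ 0 with h | h
  · simp [h]
  · field_simp

theorem integral_norm_pow_four_mul_inv :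
    ∫ v : Space3, ‖v‖ ^ 4 * ‖v‖⁻¹ ∂(stdGaussian Space3) = 12 * linCoeff := by
  rw [← integral_norm_pow_three_stdGaussian]
  congr 1 with v
  rcases eq_or_ne ‖v‖ 0 with h | h
  · simp [h]
  · field_simp

/-- The coefficients of `polyWeight` are those making the remainder field orthogonal to `v`, as
here, and to `‖v‖² v`, as in the next lemma. -/
theorem integral_norm_sq_mul_remWeight :
    ∫ v : Space3, ‖v‖ ^ 2 * remWeight ‖v‖ ∂(stdGaussian Space3) = 0 := by
  have e : ∀ v : Space3, ‖v‖ ^ 2 * remWeight ‖v‖ =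
      ‖v‖ ^ 2 * ‖v‖⁻¹ - (3 / 2 * linCoeff * ‖v‖ ^ 2 - linCoeff / 10 * ‖v‖ ^ 4) := by
    intro v; unfold remWeight polyWeight; ring
  have i0 : Integrable (fun v : Space3 => ‖v‖ ^ 2 * ‖v‖⁻¹) (stdGaussian Space3) :=
    (((PolyGrowth.norm (E := Space3)).mul radialWeight_inv.polyGrowth_norm_mul).integrable).congr
      (ae_of_all _ fun v => by simp only; ring)
  have i1 : Integrable (fun v : Space3 => 3 / 2 * linCoeff * ‖v‖ ^ 2 - linCoeff / 10 * ‖v‖ ^ 4)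
      (stdGaussian Space3) :=
    ((integrable_norm_pow 2).const_mul _).sub ((integrable_norm_pow 4).const_mul _)
  simp_rw [e]
  rw [integral_sub i0 i1,
    integral_sub ((integrable_norm_pow 2).const_mul _) ((integrable_norm_pow 4).const_mul _),
    integral_const_mul, integral_const_mul, integral_norm_sq_mul_inv,
    integral_norm_sq_stdGaussian, integral_norm_pow_four_stdGaussian]
  ring

theorem integral_norm_pow_four_mul_remWeight :
    ∫ v : Space3, ‖v‖ ^ 4 * remWeight ‖v‖ ∂(stdGaussian Space3) = 0 := by
  have e : ∀ v : Space3, ‖v‖ ^ 4 * remWeight ‖v‖ =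
      ‖v‖ ^ 4 * ‖v‖⁻¹ - (3 / 2 * linCoeff * ‖v‖ ^ 4 - linCoeff / 10 * ‖v‖ ^ 6) := by
    intro v; unfold remWeight polyWeight; ring
  have i0 : Integrable (fun v : Space3 => ‖v‖ ^ 4 * ‖v‖⁻¹) (stdGaussian Space3) :=
    ((((PolyGrowth.norm (E := Space3)).pow 3).mul
      radialWeight_inv.polyGrowth_norm_mul).integrable).congr
      (ae_of_all _ fun v => by simp only; ring)
  have i1 : Integrable (fun v : Space3 => 3 / 2 * linCoeff * ‖v‖ ^ 4 - linCoeff / 10 * ‖v‖ ^ 6)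
      (stdGaussian Space3) :=
    ((integrable_norm_pow 4).const_mul _).sub ((integrable_norm_pow 6).const_mul _)
  simp_rw [e]
  rw [integral_sub i0 i1,
    integral_sub ((integrable_norm_pow 4).const_mul _) ((integrable_norm_pow 6).const_mul _),
    integral_const_mul, integral_const_mul, integral_norm_pow_four_mul_inv,
    integral_norm_pow_four_stdGaussian, integral_norm_pow_six_stdGaussian]
  ring

/-- This is Pythagoras for `v/‖v‖`: the truncation has squared norm `3A² + 30 (A/10)²`, since
`E‖v‖²(‖v‖² - 5)² = 30`. -/
theorem integral_norm_sq_mul_remWeight_sq_le :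
    ∫ v : Space3, ‖v‖ ^ 2 * remWeight ‖v‖ ^ 2 ∂(stdGaussian Space3) ≤
      1 - 33 / 10 * linCoeff ^ 2 := by
  set A := linCoeff
  -- Equality fails only at `v = 0`, where the left side is 0 and the right side is 1.
  have e : ∀ v : Space3, ‖v‖ ^ 2 * remWeight ‖v‖ ^ 2 ≤
      1 + (-3 * A) * ‖v‖ ^ 1 + (A / 5) * ‖v‖ ^ 3 + (9 / 4 * A ^ 2) * ‖v‖ ^ 2 +
        (-3 / 10 * A ^ 2) * ‖v‖ ^ 4 + (A ^ 2 / 100) * ‖v‖ ^ 6 := by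
    intro v
    unfold remWeight polyWeight
    rcases eq_or_ne ‖v‖ 0 with h | h
    · simp [h]
    · apply le_of_eq; field_simp; ring
  have p := fun (c : ℝ) (k : ℕ) => (PolyGrowth.const (E := Space3) c).mul (PolyGrowth.norm.pow k)
  have p1 := (PolyGrowth.const 1).add (p (-3 * A) 1)
  have p2 := p1.add (p (A / 5) 3)
  have p3 := p2.add (p (9 / 4 * A ^ 2) 2)
  have p4 := p3.add (p (-3 / 10 * A ^ 2) 4)
  have p5 := p4.add (p (A ^ 2 / 100) 6)
  have i0 : Integrable (fun v : Space3 => ‖v‖ ^ 2 * remWeight ‖v‖ ^ 2) (stdGaussian Space3) :=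
    ((radialWeight_remWeight.polyGrowth_norm_mul (E := Space3)).pow 2).integrable.congr
      (ae_of_all _ fun v => by simp only; ring)
  refine (integral_mono i0 p5.integrable e).trans (le_of_eq ?_)
  rw [integral_add p4.integrable (p _ 6).integrable, integral_add p3.integrable (p _ 4).integrable,
    integral_add p2.integrable (p _ 2).integrable, integral_add p1.integrable (p _ 3).integrable,
    integral_add (PolyGrowth.const 1).integrable (p _ 1).integrable]
  simp only [integral_const_mul, integral_norm_sq_stdGaussian, integral_norm_pow_four_stdGaussian,
    integral_norm_pow_six_stdGaussian, integral_norm_pow_three_stdGaussian, pow_one,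
    integral_norm_stdGaussian, integral_const, probReal_univ, smul_eq_mul]
  ring

end Weights

/-! ### Lower bound for correlations of normalized Gaussian triples. -/

section RoundingBound

variable {E : Type*} [NormedAddCommGroup E] [InnerProductSpace ℝ E]
  [MeasurableSpace E] [BorelSpace E] [FiniteDimensional ℝ E] {x y : Fin 3 → E}

theorem integral_polyField_mul_radial {w : ℝ → ℝ} (hw : RadialWeight w) (hx : Orthonormal ℝ x)
    (hy : Orthonormal ℝ y) (a b : Fin 3) :
    ∫ r, coordMap x r a * polyWeight ‖coordMap x r‖ *
        (coordMap y r b * w ‖coordMap y r‖) ∂(stdGaussian E) =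
      linCoeff * (crossGram x y a b *
        ((∫ v : Space3, ‖v‖ ^ 2 * w ‖v‖ ∂(stdGaussian Space3)) / 3)) - linCoeff / 10 *
      (((∫ v : Space3, ‖v‖ ^ 4 * w ‖v‖ ∂(stdGaussian Space3)) / 15 -
        (∫ v : Space3, ‖v‖ ^ 2 * w ‖v‖ ∂(stdGaussian Space3)) / 3) *
        cubicForm (crossGram x y) a b) := by
  rw [← integral_linear_mul_radial hw hy, ← integral_cubic_mul_radial hw hx hy,
    ← integral_const_mul, ← integral_const_mul, ← integral_sub]
  · congr 1 with r
    unfold polyWeight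
    ring
  · exact (((polyGrowth_coord a).comp_clm (coordMap x)).mul
      ((hw.polyGrowth_coord_mul b).comp_clm (coordMap y))).integrable.const_mul _
  · exact ((((polyGrowth_coord a).comp_clm (coordMap x)).mul
      (((PolyGrowth.norm.pow 2).comp_clm (coordMap x)).sub (PolyGrowth.const 5))).mul
      ((hw.polyGrowth_coord_mul b).comp_clm (coordMap y))).integrable.const_mul _

/-- The radial moments of `v/‖v‖` give linear coefficient `A` and cubic coefficient `12A/15 - A =
-A/5`; multiplied by the `-A/10` of the truncation, the latter becomes `A²/50`. -/
theorem integral_polyField_mul_inv (hx : Orthonormal ℝ x) (hy : Orthonormal ℝ y) (a b : Fin 3) :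
    ∫ r, coordMap x r a * polyWeight ‖coordMap x r‖ *
        (coordMap y r b * ‖coordMap y r‖⁻¹) ∂(stdGaussian E) =
      linCoeff ^ 2 * (crossGram x y a b + cubicForm (crossGram x y) a b / 50) := by
  rw [integral_polyField_mul_radial radialWeight_inv hx hy, integral_norm_sq_mul_inv,
    integral_norm_pow_four_mul_inv]
  ring

/-- With `x` and `y` exchanged, the polynomial field is the one expanded and the remainder enters
only through its two vanishing radial moments. -/
theorem integral_remField_mul_polyField (hx : Orthonormal ℝ x) (hy : Orthonormal ℝ y)
    (a b : Fin 3) :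
    ∫ r, coordMap x r a * remWeight ‖coordMap x r‖ *
        (coordMap y r b * polyWeight ‖coordMap y r‖) ∂(stdGaussian E) = 0 := by
  have h := integral_polyField_mul_radial radialWeight_remWeight hy hx b a
  rw [integral_norm_sq_mul_remWeight, integral_norm_pow_four_mul_remWeight] at h
  simp_rw [mul_comm (coordMap x _ a * _)]
  rw [h]; ring

theorem integral_inner_mul_remWeight_sq_le (t : Space3) (hx : Orthonormal ℝ x) :
    Integrable (fun r => (inner ℝ t (coordMap x r) * remWeight ‖coordMap x r‖) ^ 2)
      (stdGaussian E) ∧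
    ∫ r, (inner ℝ t (coordMap x r) * remWeight ‖coordMap x r‖) ^ 2 ∂(stdGaussian E) ≤
      ‖t‖ ^ 2 * ((1 - 33 / 10 * linCoeff ^ 2) / 3) := by
  have g : ∀ t : Space3, PolyGrowth fun v : Space3 => (inner ℝ t v * remWeight ‖v‖) ^ 2 :=
    fun t => (radialWeight_remWeight.polyGrowth_inner_mul t).pow 2
  refine ⟨((g t).comp_clm (coordMap x)).integrable, ?_⟩
  rw [integral_comp_coordMap hx (g t)]
  have he : ‖(EuclideanSpace.single 0 (1 : ℝ) : Space3)‖ = 1 := by simp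
  have h := integral_inner_sq_mul (E := Space3) (w := fun r => remWeight r ^ 2)
    (fun t => (g t).integrable.congr (ae_of_all _ fun v => by simp only; ring)) he
  simp only [finrank_euclideanSpace, Fintype.card_fin, Nat.cast_ofNat] at h
  simp_rw [mul_pow]
  rw [integral_inner_pow_mul (fun r => remWeight r ^ 2) 2 he t]
  have hb := integral_norm_sq_mul_remWeight_sq_le
  rw [h] at hb
  gcongr
  linarith

/-- For a partial isometry `R`, the bilinear form of `R` is bounded below. -/
theorem bilin_ge_of_partialIsometry {R : Matrix (Fin 3) (Fin 3) ℝ} (hR : R * R.transpose * R = R)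
    (u v : Fin 3 → ℝ) :
    -(1 / 2) * (∑ b, (∑ a, R.transpose b a * u a) ^ 2 +
      ∑ c, (∑ b, (R.transpose * R) c b * v b) ^ 2) ≤ ∑ a, ∑ b, R a b * (u a * v b) := by
  have h : ∑ a, ∑ b, R a b * (u a * v b) =
      ∑ c, (∑ a, R.transpose c a * u a) * (∑ b, (R.transpose * R) c b * v b) := by
    have h1 : ∑ a, ∑ b, R a b * (u a * v b) = u ⬝ᵥ R.mulVec v := by
      simp only [dotProduct, Matrix.mulVec, Finset.mul_sum]
      exact Finset.sum_congr rfl fun a _ => Finset.sum_congr rfl fun b _ => by ring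
    rw [h1]
    conv_lhs => rw [← hR]
    rw [Matrix.mul_assoc, ← Matrix.mulVec_mulVec, Matrix.dotProduct_mulVec,
      ← Matrix.mulVec_transpose]
    rfl
  rw [h, mul_add, Finset.mul_sum, Finset.mul_sum, ← Finset.sum_add_distrib]
  refine Finset.sum_le_sum fun c _ => ?_
  nlinarith [sq_nonneg ((∑ a, R.transpose c a * u a) + (∑ b, (R.transpose * R) c b * v b))]

/-- Lower bound for correlations of rounded Gaussian triples. -/
theorem integral_rounded_ge (hx : Orthonormal ℝ x) (hy : Orthonormal ℝ y)
    {R : Matrix (Fin 3) (Fin 3) ℝ} (hR : R * R.transpose * R = R) :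
    linCoeff ^ 2 * ((∑ a, ∑ b, R a b * crossGram x y a b) +
        (∑ a, ∑ b, R a b * cubicForm (crossGram x y) a b) / 50) -
      (∑ a, ∑ b, R a b ^ 2) * ((1 - 33 / 10 * linCoeff ^ 2) / 3) ≤
    ∫ r, ∑ a, ∑ b, R a b * ((coordMap x r a * ‖coordMap x r‖⁻¹) *
      (coordMap y r b * ‖coordMap y r‖⁻¹)) ∂(stdGaussian E) := by
  have fld : ∀ {w : ℝ → ℝ}, RadialWeight w → ∀ (z : Fin 3 → E) a,
      PolyGrowth fun r => coordMap z r a * w ‖coordMap z r‖ := fun hw z a =>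
    (hw.polyGrowth_coord_mul a).comp_clm (coordMap z)
  have wi := radialWeight_inv
  have wp := radialWeight_polyWeight
  have wg := radialWeight_remWeight
  set p : (Fin 3 → E) → E → Fin 3 → ℝ := fun z r a => coordMap z r a * polyWeight ‖coordMap z r‖ with hp
  set g : (Fin 3 → E) → E → Fin 3 → ℝ := fun z r a => coordMap z r a * remWeight ‖coordMap z r‖ with hg
  set f : (Fin 3 → E) → E → Fin 3 → ℝ := fun z r a => coordMap z r a * ‖coordMap z r‖⁻¹ with hf
  -- `f ⊗ f = p ⊗ f + g ⊗ p + g ⊗ g`: the first term is computed exactly, the second integrates to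
  -- zero, and only the last is estimated.
  have split : ∀ r, ∑ a, ∑ b, R a b * (f x r a * f y r b) =
      ∑ a, ∑ b, R a b * (p x r a * f y r b) + ∑ a, ∑ b, R a b * (g x r a * p y r b) +
        ∑ a, ∑ b, R a b * (g x r a * g y r b) := by
    intro r
    simp only [← Finset.sum_add_distrib]
    refine Finset.sum_congr rfl fun a _ => Finset.sum_congr rfl fun b _ => ?_
    simp only [hf, hg, hp, remWeight]
    ring
  have int2 : ∀ {s t : E → Fin 3 → ℝ}, (∀ a, PolyGrowth fun r => s r a) →
      (∀ a, PolyGrowth fun r => t r a) → ∀ a b,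
      PolyGrowth fun r => R a b * (s r a * t r b) := fun hs ht a b =>
    (PolyGrowth.const (R a b)).mul ((hs a).mul (ht b))
  have dbl : ∀ {s t : E → Fin 3 → ℝ}, (∀ a, PolyGrowth fun r => s r a) →
      (∀ a, PolyGrowth fun r => t r a) →
      PolyGrowth fun r => ∑ a, ∑ b, R a b * (s r a * t r b) := fun hs ht =>
    PolyGrowth.sum _ fun a => PolyGrowth.sum _ fun b => int2 hs ht a b
  have dblint : ∀ {s t : E → Fin 3 → ℝ}, (∀ a, PolyGrowth fun r => s r a) →
      (∀ a, PolyGrowth fun r => t r a) →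
      ∫ r, ∑ a, ∑ b, R a b * (s r a * t r b) ∂(stdGaussian E) =
      ∑ a, ∑ b, R a b * ∫ r, s r a * t r b ∂(stdGaussian E) := by
    intro s t hs ht
    rw [integral_finsetSum _ fun a _ => (PolyGrowth.sum _ fun b => int2 hs ht a b).integrable]
    refine Finset.sum_congr rfl fun a _ => ?_
    rw [integral_finsetSum _ fun b _ => (int2 hs ht a b).integrable]
    exact Finset.sum_congr rfl fun b _ => integral_const_mul _ _
  have gpf := dbl (fld wp x) (fld wi y)
  have ggp := dbl (fld wg x) (fld wp y)
  have ggg := dbl (fld wg x) (fld wg y)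
  have e1 : ∫ r, ∑ a, ∑ b, R a b * (p x r a * f y r b) ∂(stdGaussian E) =
      linCoeff ^ 2 * ((∑ a, ∑ b, R a b * crossGram x y a b) +
        (∑ a, ∑ b, R a b * cubicForm (crossGram x y) a b) / 50) := by
    rw [dblint (fld wp x) (fld wi y), Finset.sum_div, ← Finset.sum_add_distrib, Finset.mul_sum]
    refine Finset.sum_congr rfl fun a _ => ?_
    rw [Finset.sum_div, ← Finset.sum_add_distrib, Finset.mul_sum]
    refine Finset.sum_congr rfl fun b _ => ?_
    rw [integral_polyField_mul_inv hx hy]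
    ring
  have e2 : ∫ r, ∑ a, ∑ b, R a b * (g x r a * p y r b) ∂(stdGaussian E) = 0 := by
    rw [dblint (fld wg x) (fld wp y)]
    refine Finset.sum_eq_zero fun a _ => Finset.sum_eq_zero fun b _ => ?_
    rw [integral_remField_mul_polyField hx hy, mul_zero]
  -- By isotropy each row of `L` contributes its squared length times at most a third of `1 -
  -- 33A²/10`.
  have sq : ∀ (L : Matrix (Fin 3) (Fin 3) ℝ) {z : Fin 3 → E} (hz : Orthonormal ℝ z),
      Integrable (fun r => ∑ c, (∑ a, L c a * g z r a) ^ 2) (stdGaussian E) ∧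
      ∫ r, ∑ c, (∑ a, L c a * g z r a) ^ 2 ∂(stdGaussian E) ≤
        (∑ c, ∑ a, L c a ^ 2) * ((1 - 33 / 10 * linCoeff ^ 2) / 3) := by
    intro L z hz
    have e : ∀ r c, ∑ a, L c a * g z r a =
        inner ℝ (WithLp.toLp 2 (L c) : Space3) (coordMap z r) * remWeight ‖coordMap z r‖ := by
      intro r c
      simp only [hg, PiLp.inner_apply, Finset.sum_mul]
      exact Finset.sum_congr rfl fun a _ => by simp; ring
    simp_rw [e]
    have hc := fun c => integral_inner_mul_remWeight_sq_le (WithLp.toLp 2 (L c) : Space3) hz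
    refine ⟨integrable_finsetSum _ fun c _ => (hc c).1, ?_⟩
    rw [integral_finsetSum _ fun c _ => (hc c).1, Finset.sum_mul]
    refine Finset.sum_le_sum fun c _ => (hc c).2.trans (le_of_eq ?_)
    rw [EuclideanSpace.real_norm_sq_eq]
  have e3 : -((∑ a, ∑ b, R a b ^ 2) * ((1 - 33 / 10 * linCoeff ^ 2) / 3)) ≤
      ∫ r, ∑ a, ∑ b, R a b * (g x r a * g y r b) ∂(stdGaussian E) := by
    have s1 := sq R.transpose hx
    have s2 := sq (R.transpose * R) hy
    have hn1 : ∑ c, ∑ a, R.transpose c a ^ 2 = ∑ a, ∑ b, R a b ^ 2 := Finset.sum_comm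
    -- `RᵀR` is an orthogonal projection, so its squared Frobenius norm is its trace, which is that
    -- of `R`.
    have hn2 : ∑ c, ∑ a, (R.transpose * R) c a ^ 2 = ∑ a, ∑ b, R a b ^ 2 := by
      have t1 : ∀ L : Matrix (Fin 3) (Fin 3) ℝ, ∑ c, ∑ a, L c a ^ 2 = (L.transpose * L).trace := by
        intro L
        rw [Finset.sum_comm]
        simp [Matrix.trace, Matrix.mul_apply, pow_two]
      rw [t1, t1, Matrix.transpose_mul, Matrix.transpose_transpose, Matrix.mul_assoc,
        ← Matrix.mul_assoc R, hR]
    have hm := integral_mono ((s1.1.add s2.1).const_mul (-(1 / 2))) ggg.integrable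
      (fun r => bilin_ge_of_partialIsometry hR (g x r) (g y r))
    refine le_trans ?_ hm
    rw [integral_const_mul]
    simp only [Pi.add_apply]
    rw [integral_add s1.1 s2.1]
    have := s1.2
    have := s2.2
    rw [hn1] at *
    rw [hn2] at *
    linarith
  have : ∫ r, ∑ a, ∑ b, R a b * (f x r a * f y r b) ∂(stdGaussian E) = _ :=
    integral_congr_ae (ae_of_all _ split)
  rw [this, integral_add (gpf.add ggp).integrable ggg.integrable,
    integral_add gpf.integrable ggp.integrable, e1, e2]
  linarith

end RoundingBound

/-! ### Inequalities for 3×3 contractions and the approximation factors. -/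

section MatrixInequalities

/-- Euclidean contractions on `ℝ³`, together with their transposes. -/
def IsContraction (T : Matrix (Fin 3) (Fin 3) ℝ) : Prop :=
  (∀ v, ∑ a, T.mulVec v a ^ 2 ≤ ∑ a, v a ^ 2) ∧ ∀ v, ∑ a, T.transpose.mulVec v a ^ 2 ≤ ∑ a, v a ^ 2

/-- The cubic form paired with the identity. -/
def cubicTrace (X : Matrix (Fin 3) (Fin 3) ℝ) : ℝ := (cubicForm X).trace

theorem IsContraction.transpose {T : Matrix (Fin 3) (Fin 3) ℝ} (h : IsContraction T) :
    IsContraction T.transpose :=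
  ⟨h.2, by simpa using h.1⟩

theorem sum_sq_eq_dotProduct (v : Fin 3 → ℝ) : ∑ a, v a ^ 2 = v ⬝ᵥ v := by
  simp [dotProduct, pow_two]

theorem IsContraction.abs_quadratic_le {X : Matrix (Fin 3) (Fin 3) ℝ} (h : IsContraction X)
    (v : Fin 3 → ℝ) : |v ⬝ᵥ X.mulVec v| ≤ ∑ a, v a ^ 2 := by
  have h1 := h.1 v
  have h2 : 0 ≤ ∑ a, (v a - X.mulVec v a) ^ 2 := Finset.sum_nonneg fun a _ => sq_nonneg _
  have h3 : 0 ≤ ∑ a, (v a + X.mulVec v a) ^ 2 := Finset.sum_nonneg fun a _ => sq_nonneg _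
  simp only [dotProduct, Fin.sum_univ_three] at *
  rw [abs_le]
  constructor <;> nlinarith

theorem IsContraction.sum_sq_le {X : Matrix (Fin 3) (Fin 3) ℝ} (h : IsContraction X) :
    ∑ a, ∑ b, X a b ^ 2 ≤ 3 := by
  have h1 := fun i => h.2 (Pi.single i 1)
  simp only [Matrix.mulVec_single_one, Matrix.col_apply, Matrix.transpose_apply] at h1
  calc ∑ a, ∑ b, X a b ^ 2 ≤ ∑ a : Fin 3, ∑ b, (Pi.single a 1 : Fin 3 → ℝ) b ^ 2 :=
        Finset.sum_le_sum fun a _ => h1 a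
    _ = 3 := by simp [Pi.single_apply]

theorem IsContraction.trace_sq_le {X : Matrix (Fin 3) (Fin 3) ℝ} (h : IsContraction X) :
    |X.trace| ≤ 3 := by
  have h0 := h.sum_sq_le
  simp only [Matrix.trace, Matrix.diag, Fin.sum_univ_three] at *
  rw [abs_le]
  constructor <;> nlinarith [sq_nonneg (X 0 0 - 1), sq_nonneg (X 1 1 - 1), sq_nonneg (X 2 2 - 1),
    sq_nonneg (X 0 0 + 1), sq_nonneg (X 1 1 + 1), sq_nonneg (X 2 2 + 1),
    sq_nonneg (X 0 1), sq_nonneg (X 0 2), sq_nonneg (X 1 0), sq_nonneg (X 1 2), sq_nonneg (X 2 0),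
    sq_nonneg (X 2 1)]

theorem IsContraction.mul {X Y : Matrix (Fin 3) (Fin 3) ℝ} (hX : IsContraction X)
    (hY : IsContraction Y) : IsContraction (X * Y) := by
  refine ⟨fun v => ?_, fun v => ?_⟩
  · rw [← Matrix.mulVec_mulVec]; exact (hX.1 _).trans (hY.1 v)
  · rw [Matrix.transpose_mul, ← Matrix.mulVec_mulVec]; exact (hY.2 _).trans (hX.2 v)

theorem isContraction_of_orthogonal {R : Matrix (Fin 3) (Fin 3) ℝ} (hR : R * R.transpose = 1) :
    IsContraction R := by
  have hR' : R.transpose * R = 1 := mul_eq_one_comm.mp hR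
  have key : ∀ (M : Matrix (Fin 3) (Fin 3) ℝ), M.transpose * M = 1 → ∀ v,
      ∑ a, M.mulVec v a ^ 2 ≤ ∑ a, v a ^ 2 := by
    intro M hM v
    rw [sum_sq_eq_dotProduct, sum_sq_eq_dotProduct, Matrix.dotProduct_mulVec,
      ← Matrix.mulVec_transpose, Matrix.mulVec_mulVec, hM, Matrix.one_mulVec]
  exact ⟨key R hR', key R.transpose (by simpa using hR)⟩

/-- Here `cubicTrace X = tr X ‖X‖² + 2 tr(X XᵀX)`, where `‖X‖² ≤ 3`, `|tr X| ≤ 3`, and the last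
trace is at least `-(‖X‖² + ‖XᵀX‖²)/2 ≥ -3`. -/
theorem IsContraction.cubicTrace_ge {X : Matrix (Fin 3) (Fin 3) ℝ} (h : IsContraction X) :
    -15 ≤ cubicTrace X ∧ (|X.trace| ≤ 1 → -9 ≤ cubicTrace X) := by
  have e : cubicTrace X = X.trace * (∑ a, ∑ b, X a b ^ 2) + 2 * (X * (X.transpose * X)).trace := by
    simp [cubicTrace, cubicForm, Matrix.trace_add, Matrix.trace_smul, Matrix.mul_assoc, mul_comm]
  have h1 := h.sum_sq_le
  have h2 := (h.transpose.mul h).sum_sq_le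
  have h3 := abs_le.mp h.trace_sq_le
  have h0 : 0 ≤ ∑ a, ∑ b, X a b ^ 2 := by positivity
  have h4 : -3 ≤ (X * (X.transpose * X)).trace := by
    set Y := X.transpose * X
    have : (X * Y).trace = ∑ a, ∑ b, X a b * Y b a := by simp [Matrix.trace, Matrix.mul_apply]
    rw [this]
    have h5 : ∑ a, ∑ b, Y a b ^ 2 = ∑ a, ∑ b, Y b a ^ 2 := Finset.sum_comm
    have h6 : 0 ≤ ∑ a, ∑ b, (X a b + Y b a) ^ 2 := by positivity
    have h7 : ∑ a, ∑ b, (X a b + Y b a) ^ 2 = ∑ a, ∑ b, X a b ^ 2 + ∑ a, ∑ b, Y b a ^ 2 +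
        2 * ∑ a, ∑ b, X a b * Y b a := by
      simp only [Finset.mul_sum, ← Finset.sum_add_distrib]
      exact Finset.sum_congr rfl fun a _ => Finset.sum_congr rfl fun b _ => by ring
    linarith
  rw [e]
  refine ⟨by nlinarith, fun h1 => ?_⟩
  have := abs_le.mp h1
  nlinarith

/-- Multiples of the identity give equality. Write `X` as `τ/3` plus a traceless symmetric `Z` plus
an antisymmetric part with axial vector `k`. The excess of `cubicTrace X` over `5τ³/9` is `3τ‖Z‖² +
2 tr Z³ + 4τ‖k‖² - 2⟨k, Xk⟩`. Contractivity bounds `⟨k, Xk⟩` by `‖k‖²`, and applied to the rows of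
`Z` it gives `tr Z³ ≥ -(1 + τ/3)‖Z‖²`. -/
theorem IsContraction.cubicTrace_ge_of_trace_ge {X : Matrix (Fin 3) (Fin 3) ℝ}
    (h : IsContraction X) (ht : 6 / 7 ≤ X.trace) : 5 / 9 * X.trace ^ 3 ≤ cubicTrace X := by
  set τ := X.trace with hτ
  have hk := (abs_le.mp (h.abs_quadratic_le
    ![(X 2 1 - X 1 2) / 2, (X 0 2 - X 2 0) / 2, (X 1 0 - X 0 1) / 2])).2
  have z0 := (abs_le.mp (h.abs_quadratic_le
    ![X 0 0 - τ / 3, (X 0 1 + X 1 0) / 2, (X 0 2 + X 2 0) / 2])).1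
  have z1 := (abs_le.mp (h.abs_quadratic_le
    ![(X 0 1 + X 1 0) / 2, X 1 1 - τ / 3, (X 1 2 + X 2 1) / 2])).1
  have z2 := (abs_le.mp (h.abs_quadratic_le
    ![(X 0 2 + X 2 0) / 2, (X 1 2 + X 2 1) / 2, X 2 2 - τ / 3])).1
  have e1 : τ = X 0 0 + X 1 1 + X 2 2 := by simp [hτ, Matrix.trace, Fin.sum_univ_three]
  set K := ((X 2 1 - X 1 2) / 2) ^ 2 + ((X 0 2 - X 2 0) / 2) ^ 2 + ((X 1 0 - X 0 1) / 2) ^ 2 with hK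
  set Z := (X 0 0 - τ / 3) ^ 2 + (X 1 1 - τ / 3) ^ 2 + (X 2 2 - τ / 3) ^ 2 +
    2 * (((X 0 1 + X 1 0) / 2) ^ 2 + ((X 0 2 + X 2 0) / 2) ^ 2 + ((X 1 2 + X 2 1) / 2) ^ 2) with hZ
  have hK0 : 0 ≤ (4 * τ - 2) * K := mul_nonneg (by linarith) (by positivity)
  -- This coefficient is the origin of the threshold `6/7`.
  have hZ0 : 0 ≤ (7 / 3 * τ - 2) * Z := mul_nonneg (by linarith) (by positivity)
  clear_value K Z
  simp only [cubicTrace, cubicForm, Matrix.trace, Matrix.diag, Matrix.add_apply, Matrix.smul_apply,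
    Matrix.mul_apply, Matrix.transpose_apply, smul_eq_mul, Fin.sum_univ_three, dotProduct,
    Matrix.mulVec, Matrix.cons_val_zero, Matrix.cons_val_one, Matrix.cons_val] at hk z0 z1 z2 ⊢
  subst hK hZ
  clear_value τ
  subst e1
  linarith

/-- The value of the cubic form on a rank-one unit matrix. -/
theorem IsContraction.rankOne_cubic_ge {T : Matrix (Fin 3) (Fin 3) ℝ} (h : IsContraction T)
    {x y : Fin 3 → ℝ} (hx : x ⬝ᵥ x = 1) (hy : y ⬝ᵥ y = 1) :
    let t := x ⬝ᵥ T.mulVec y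
    let n := x ⬝ᵥ (cubicForm T).mulVec y
    |t| ≤ 1 ∧ -5 ≤ n ∧ (0 ≤ t → t ^ 3 + 2 * (t + t ^ 2 - 1) ≤ n) := by
  intro t n
  have cs : ∀ u v : Fin 3 → ℝ, (u ⬝ᵥ v) ^ 2 ≤ (u ⬝ᵥ u) * (v ⬝ᵥ v) := by
    intro u v
    simp only [← sum_sq_eq_dotProduct]
    exact Finset.sum_mul_sq_le_sq_mul_sq _ _ _
  have nn : ∀ u : Fin 3 → ℝ, 0 ≤ u ⬝ᵥ u := fun u => by
    rw [← sum_sq_eq_dotProduct]; positivity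
  have con : ∀ v, T.mulVec v ⬝ᵥ T.mulVec v ≤ v ⬝ᵥ v := fun v => by
    simpa only [sum_sq_eq_dotProduct] using h.1 v
  have con' : ∀ v, T.transpose.mulVec v ⬝ᵥ T.transpose.mulVec v ≤ v ⬝ᵥ v := fun v => by
    simpa only [sum_sq_eq_dotProduct] using h.2 v
  have adj : ∀ u v, u ⬝ᵥ T.mulVec v = T.transpose.mulVec u ⬝ᵥ v := fun u v => by
    rw [Matrix.dotProduct_mulVec, ← Matrix.mulVec_transpose]
  set z := T.transpose.mulVec x with hz
  set a := T.mulVec y with ha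
  set F := ∑ a, ∑ b, T a b ^ 2 with hF
  have htz : t = z ⬝ᵥ y := adj x y
  -- With `z = Tᵀx` and `a = Ty`, the form `x·TTᵀTy` equals `Tz·a`; it remains to bound `Tz·a`
  -- below.
  have hn : n = t * F + 2 * (T.mulVec z ⬝ᵥ a) := by
    have e : n = F * t + 2 * (x ⬝ᵥ T.mulVec (T.transpose.mulVec a)) := by
      simp only [n, cubicForm, Matrix.add_mulVec, Matrix.smul_mulVec, dotProduct_add,
        dotProduct_smul, smul_eq_mul, ← Matrix.mulVec_mulVec]
      rfl
    rw [e, adj x, ← hz, dotProduct_comm z, ← adj, dotProduct_comm a]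
    ring
  have hzz : z ⬝ᵥ z = x ⬝ᵥ T.mulVec z := (adj x z).symm
  have a1 : a ⬝ᵥ a ≤ 1 := hy ▸ con y
  have z1 : z ⬝ᵥ z ≤ 1 := hx ▸ con' x
  have tz1 : T.mulVec z ⬝ᵥ T.mulVec z ≤ 1 := (con z).trans z1
  have ta : t ^ 2 ≤ a ⬝ᵥ a := by have := cs x a; rwa [hx, one_mul] at this
  have tz : t ^ 2 ≤ z ⬝ᵥ z := by have := cs z y; rwa [hy, mul_one, ← htz] at this
  have ht1 : |t| ≤ 1 := by rw [← sq_le_one_iff_abs_le_one]; linarith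
  have ht := abs_le.mp ht1
  have F3 : F ≤ 3 := h.sum_sq_le
  have F0 : 0 ≤ F := by positivity
  refine ⟨ht1, ?_, fun t0 => ?_⟩
  · have h1 : -1 ≤ T.mulVec z ⬝ᵥ a := by
      have := nn (T.mulVec z + a)
      simp only [add_dotProduct, dotProduct_add] at this
      rw [dotProduct_comm a] at this
      linarith
    rw [hn]; nlinarith
  · have Ft : t ^ 2 ≤ F := by
      have h1 : a ⬝ᵥ a ≤ F := by
        rw [← sum_sq_eq_dotProduct, hF]
        refine Finset.sum_le_sum fun i _ => ?_
        have := cs (T i) y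
        rw [hy, mul_one, ← sum_sq_eq_dotProduct] at this
        exact this
      exact ta.trans h1
    have q1 : (z ⬝ᵥ z) ^ 2 ≤ T.mulVec z ⬝ᵥ T.mulVec z := by
      have := cs x (T.mulVec z)
      rwa [hx, one_mul, ← hzz] at this
    -- Expanding `‖T(z - y)‖² ≤ ‖z - y‖²` bounds `Tz·a` from below; `‖Tz‖² ≥ ‖z‖⁴`, `‖a‖² ≥ t²` and
    -- `‖z‖² ≥ t²` then finish.
    have q2 := con (z - y)
    rw [Matrix.mulVec_sub] at q2
    simp only [sub_dotProduct, dotProduct_sub, ← ha] at q2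
    rw [dotProduct_comm a, dotProduct_comm y z, ← htz, hy] at q2
    have q3 : t - (1 - t ^ 2) ≤ T.mulVec z ⬝ᵥ a := by nlinarith [sq_nonneg (1 - z ⬝ᵥ z)]
    rw [hn]
    nlinarith [mul_le_mul_of_nonneg_left Ft t0]

/-- Unit rank-one or orthogonal parts of the correlation matrices of projectors. -/
theorem exists_partialIsometry_scaling {m : ℕ} (hm : m = 1 ∨ m = 2 ∨ m = 3)
    {c : Matrix (Fin 3) (Fin 3) ℝ} (hadj : c.adjugate = ((m : ℝ) - 2) • c.transpose)
    (hn : ∑ a, ∑ b, c a b ^ 2 = m * (4 - m)) :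
    (m ≠ 2 → c * c.transpose = 1) ∧ (m = 2 → ∃ x y : Fin 3 → ℝ, x ⬝ᵥ x = 1 ∧ y ⬝ᵥ y = 1 ∧
      c = (2 : ℝ) • Matrix.vecMulVec x y) := by
  have htr : (c * c.transpose).trace = m * (4 - m) := by
    rw [← hn]; simp [Matrix.trace, Matrix.mul_apply, pow_two]
  -- From `c · adj c = det c · 1`; taking traces gives `det c = m - 2` for odd `m`, hence
  -- orthogonality.
  have hdet : ((m : ℝ) - 2) • (c * c.transpose) = c.det • (1 : Matrix (Fin 3) (Fin 3) ℝ) := by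
    rw [← Matrix.mul_adjugate, hadj, Matrix.mul_smul]
  have hdt := congrArg Matrix.trace hdet
  simp only [Matrix.trace_smul, htr, Matrix.trace_one, Fintype.card_fin, smul_eq_mul] at hdt
  refine ⟨fun h2 => ?_, fun h2 => ?_⟩
  · have h3 : ((m : ℝ) - 2) ≠ 0 := by
      rcases hm with rfl | rfl | rfl <;> first | exact absurd rfl h2 | norm_num
    have hd : c.det = (m : ℝ) - 2 := by
      rcases hm with rfl | rfl | rfl <;> first | exact absurd rfl h2 | (norm_num at hdt ⊢; linarith)
    rw [hd] at hdet
    exact smul_right_injective _ h3 hdet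
  · subst h2
    norm_num at hadj hn
    have minors : ∀ a b i j, c a b * c i j = c a j * c i b := by
      have e := fun p q => congrFun (congrFun hadj p) q
      rw [Matrix.adjugate_fin_three] at e
      have e00 := e 0 0
      have e01 := e 0 1
      have e02 := e 0 2
      have e10 := e 1 0
      have e11 := e 1 1
      have e12 := e 1 2
      have e20 := e 2 0
      have e21 := e 2 1
      have e22 := e 2 2
      simp at e00 e01 e02 e10 e11 e12 e20 e21 e22
      intro a b i j
      fin_cases a <;> fin_cases b <;> fin_cases i <;> fin_cases j <;> simp <;> linarith
    obtain ⟨i, j, hij⟩ : ∃ i j, c i j ≠ 0 := by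
      by_contra! hcon
      simp [hcon] at hn
    set P := ∑ a, c a j ^ 2 with hP
    have hPQ : P * ∑ b, c i b ^ 2 = 4 * c i j ^ 2 := by
      rw [hP, Finset.sum_mul_sum, ← hn, Finset.sum_mul]
      refine Finset.sum_congr rfl fun a _ => ?_
      rw [Finset.sum_mul]
      refine Finset.sum_congr rfl fun b _ => ?_
      rw [← mul_pow, ← mul_pow, minors]
    have hP0 : 0 < P := by
      have : c i j ^ 2 ≤ P := Finset.single_le_sum (f := fun a => c a j ^ 2)
        (fun a _ => sq_nonneg _) (Finset.mem_univ i)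
      have := sq_pos_of_ne_zero hij
      linarith
    have hs : Real.sqrt P ^ 2 = P := Real.sq_sqrt hP0.le
    have hs0 : Real.sqrt P ≠ 0 := (Real.sqrt_pos.mpr hP0).ne'
    -- As all 2×2 minors vanish, `c` is determined by column `j` and row `i` through a nonzero
    -- entry; `‖c‖² = 4` makes the rescaled row a unit vector.
    refine ⟨fun a => c a j / Real.sqrt P, fun b => Real.sqrt P * c i b / (2 * c i j), ?_, ?_, ?_⟩
    · rw [← sum_sq_eq_dotProduct]
      simp only [div_pow, hs, ← Finset.sum_div]
      exact div_self hP0.ne'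
    · rw [← sum_sq_eq_dotProduct]
      simp only [div_pow, mul_pow, hs, ← Finset.sum_div, ← Finset.mul_sum]
      rw [hPQ, div_eq_one_iff_eq (by positivity)]
      ring
    · ext a b
      simp only [Matrix.smul_apply, Matrix.vecMulVec_apply, smul_eq_mul]
      field_simp
      rw [minors]

theorem sum_mul_eq_trace (R T : Matrix (Fin 3) (Fin 3) ℝ) :
    ∑ a, ∑ b, R a b * T a b = (T * R.transpose).trace := by
  simp [Matrix.trace, Matrix.mul_apply, mul_comm]

/-- Equivariance under right rotations reduces an orthogonal `c` to the identity, with `T` replaced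
by `T cᵀ`. -/
theorem cubicForm_mul_transpose {R : Matrix (Fin 3) (Fin 3) ℝ} (hR : R * R.transpose = 1)
    (T : Matrix (Fin 3) (Fin 3) ℝ) :
    cubicForm T * R.transpose = cubicForm (T * R.transpose) := by
  have hR' : R.transpose * R = 1 := mul_eq_one_comm.mp hR
  have h1 : ∀ L : Matrix (Fin 3) (Fin 3) ℝ, ∑ a, ∑ b, L a b ^ 2 = (L * L.transpose).trace := by
    intro L; simp [Matrix.trace, Matrix.mul_apply, pow_two]
  have h2 : T * R.transpose * (T * R.transpose).transpose = T * T.transpose := by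
    rw [Matrix.transpose_mul, Matrix.transpose_transpose, Matrix.mul_assoc,
      ← Matrix.mul_assoc R.transpose, hR', Matrix.one_mul]
  simp only [cubicForm, h1, h2, Matrix.add_mul, Matrix.smul_mul, Matrix.mul_assoc]

theorem linCoeff_sq_bounds : 28 / 100 < linCoeff ^ 2 ∧ linCoeff ^ 2 < 29 / 100 := by
  rw [linCoeff_sq]
  have h1 := Real.pi_gt_d2
  have h2 := Real.pi_lt_d2
  constructor
  · rw [lt_div_iff₀ (by positivity)]; linarith
  · rw [div_lt_iff₀ (by positivity)]; linarith

theorem alphaSQ_one : alphaSQ 1 = 33 / 20 * linCoeff ^ 2 := by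
  rw [linCoeff_sq, alphaSQ]; field_simp; ring

theorem alphaSQ_two : alphaSQ 2 = 1 / 3 + 27 / 25 * linCoeff ^ 2 := by
  rw [linCoeff_sq, alphaSQ]; field_simp; ring

theorem alphaSQ_three : alphaSQ 3 = 1 / 2 + 97 / 90 * linCoeff ^ 2 := by
  rw [linCoeff_sq, alphaSQ]; field_simp; ring

theorem alphaSQ_le_of_le {k m : ℕ} (hk : k = 1 ∨ k = 2 ∨ k = 3) (hm : m = 1 ∨ m = 2 ∨ m = 3)
    (h : k ≤ m) : alphaSQ k ≤ alphaSQ m := by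
  have := linCoeff_sq_bounds
  rcases hk with rfl | rfl | rfl <;> rcases hm with rfl | rfl | rfl <;>
    first | omega | (simp only [alphaSQ_one, alphaSQ_two, alphaSQ_three]; linarith)

theorem alphaSQ_le_one {k : ℕ} (hk : k = 1 ∨ k = 2 ∨ k = 3) : alphaSQ k ≤ 1 := by
  refine (alphaSQ_le_of_le hk (Or.inr (Or.inr rfl)) (by omega)).trans ?_
  have := linCoeff_sq_bounds
  rw [alphaSQ_three]; linarith

/-- The guaranteed value of a partial isometry `R` for the cubic truncation. -/
def truncatedValue (R T : Matrix (Fin 3) (Fin 3) ℝ) : ℝ :=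
  linCoeff ^ 2 * ((∑ a, ∑ b, R a b * T a b) + (∑ a, ∑ b, R a b * cubicForm T a b) / 50) -
    (∑ a, ∑ b, R a b ^ 2) * ((1 - 33 / 10 * linCoeff ^ 2) / 3)

/-- Each factor is the ratio of the truncated bound to the relaxation at a point of relaxation value
1: `T cᵀ = 1` for `m = 1`, `T = x yᵀ` for `m = 2`, `T cᵀ = 1/3` for `m = 3`. The hypothesis `hle`
says that the relaxation is worth at most 1; for `m = 3` it cuts `tr(T cᵀ)` down to at most 1. -/
theorem truncatedValue_ge {m : ℕ} (hm : m = 1 ∨ m = 2 ∨ m = 3)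
    {c T : Matrix (Fin 3) (Fin 3) ℝ} (hadj : c.adjugate = ((m : ℝ) - 2) • c.transpose)
    (hn : ∑ a, ∑ b, c a b ^ 2 = m * (4 - m)) (hT : IsContraction T)
    (hle : ∑ a, ∑ b, c a b * T a b ≤ 4 - m) :
    ∃ (s : ℝ) (R : Matrix (Fin 3) (Fin 3) ℝ), 0 ≤ s ∧ c = s • R ∧ R * R.transpose * R = R ∧
      alphaSQ m * (m + ∑ a, ∑ b, c a b * T a b) ≤ m + s * truncatedValue R T := by
  obtain ⟨horth, hrank⟩ := exists_partialIsometry_scaling hm hadj hn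
  obtain ⟨hq1, hq2⟩ := linCoeff_sq_bounds
  by_cases h2 : m = 2
  · obtain ⟨x, y, hx, hy, hc⟩ := hrank h2
    have hxy : ∀ M : Matrix (Fin 3) (Fin 3) ℝ, ∑ a, ∑ b, Matrix.vecMulVec x y a b * M a b =
        x ⬝ᵥ M.mulVec y := by
      intro M
      simp only [Matrix.vecMulVec_apply, dotProduct, Matrix.mulVec, Finset.mul_sum]
      exact Finset.sum_congr rfl fun a _ => Finset.sum_congr rfl fun b _ => by ring
    have hone : ∑ a, ∑ b, Matrix.vecMulVec x y a b ^ 2 = 1 := by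
      simp only [Matrix.vecMulVec_apply, mul_pow, ← Finset.mul_sum, ← Finset.sum_mul]
      rw [sum_sq_eq_dotProduct, sum_sq_eq_dotProduct, hx, hy, one_mul]
    refine ⟨2, Matrix.vecMulVec x y, by norm_num, hc, ?_, ?_⟩
    · rw [Matrix.transpose_vecMulVec, Matrix.vecMulVec_mul_vecMulVec, hy, one_smul,
        Matrix.vecMulVec_mul_vecMulVec, hx, one_smul]
    · have hv : ∑ a, ∑ b, c a b * T a b = 2 * (x ⬝ᵥ T.mulVec y) := by
        rw [← hxy, hc]
        simp only [Matrix.smul_apply, smul_eq_mul, Finset.mul_sum, mul_assoc]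
      rw [hv, truncatedValue, hxy, hxy, hone, h2, alphaSQ_two]
      obtain ⟨h1, h3, h4⟩ := hT.rankOne_cubic_ge hx hy
      set t := x ⬝ᵥ T.mulVec y
      set n := x ⬝ᵥ (cubicForm T).mulVec y
      set q := linCoeff ^ 2
      obtain ⟨t1, t2⟩ := abs_le.mp h1
      push_cast
      have key : 0 ≤ (1 - t) / 3 + q * (1 / 50 - 2 / 25 * t + n / 50) := by
        rcases le_or_gt 0 t with ht | ht
        · have h5 := h4 ht
          -- After inserting the bound on `n`, the target factors with root at the extremal `t = 1`.
          have h6 : 0 ≤ (1 - t) * (1 / 3 - q / 50 * (t ^ 2 + 3 * t + 1)) := by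
            refine mul_nonneg (by linarith) ?_
            nlinarith
          nlinarith
        · nlinarith
      linarith
  · have hc := horth h2
    have hX : IsContraction (T * c.transpose) :=
      hT.mul (isContraction_of_orthogonal hc).transpose
    refine ⟨1, c, zero_le_one, (one_smul _ _).symm, by rw [hc, Matrix.one_mul], ?_⟩
    have h3 : ∑ a, ∑ b, c a b ^ 2 = 3 := by
      rw [hn]; rcases hm with rfl | rfl | rfl <;> first | exact absurd rfl h2 | norm_num
    rw [truncatedValue, h3, sum_mul_eq_trace, sum_mul_eq_trace, cubicForm_mul_transpose hc,
      ← cubicTrace]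
    rw [sum_mul_eq_trace] at hle
    set X := T * c.transpose
    have g1 := hX.cubicTrace_ge
    have g2 := hX.cubicTrace_ge_of_trace_ge
    have g3 := abs_le.mp hX.trace_sq_le
    set τ := X.trace
    set N := cubicTrace X
    set q := linCoeff ^ 2
    rcases hm with rfl | rfl | rfl
    · rw [alphaSQ_one]
      push_cast at hle ⊢
      have key : 0 ≤ q * (N / 50 + 33 / 20 - 13 / 20 * τ) := by
        refine mul_nonneg (by linarith) ?_
        rcases le_or_gt (6 / 7) τ with ht | ht
        · nlinarith [g2 ht, mul_nonneg (sub_nonneg.mpr g3.2) (sub_nonneg.mpr ht),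
            mul_nonneg (mul_nonneg (sub_nonneg.mpr g3.2) (sub_nonneg.mpr ht)) (sub_nonneg.mpr ht)]
        · linarith [g1.1]
      linarith
    · exact absurd rfl h2
    · rw [alphaSQ_three]
      push_cast at hle ⊢
      have key : 0 ≤ (1 - τ) / 2 + q * (N / 50 - 1 / 90 + 7 / 90 * (1 - τ)) := by
        rcases le_or_gt (6 / 7) τ with ht | ht
        -- The tangent to `5τ³/9` at the extremal point `τ = 1`.
        · have h5 : 5 / 9 - 5 / 3 * (1 - τ) ≤ N := by
            refine le_trans ?_ (g2 ht)
            nlinarith [mul_nonneg (sub_nonneg.mpr ht) (sq_nonneg (τ - 1)), sq_nonneg (τ - 1)]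
          nlinarith
        -- Near `6/7` the crude bound `-15` is too weak, so the bound `-9` for `|τ| ≤ 1` is needed.
        · rcases le_or_gt (-1) τ with hm1 | hm1
          · have h5 := g1.2 (abs_le.mpr ⟨hm1, by linarith⟩)
            nlinarith
          · nlinarith [g1.1]
      linarith

end MatrixInequalities

/-! ### Pauli algebra on two qubits. -/

section Pauli

theorem pauli_conjTranspose (k : Fin 4) : (pauli k).conjTranspose = pauli k := by
  ext i j
  fin_cases k <;> fin_cases i <;> fin_cases j <;> simp [pauli]

theorem pauliTrace_im {A : TwoQubitOp} (hA : A.IsHermitian) (k l : Fin 4) :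
    (pauliTrace k l A).im = 0 := by
  rw [← Complex.conj_eq_iff_im]
  have h : star (pauliTrace k l A) = pauliTrace k l A := by
    rw [pauliTrace, ← Matrix.trace_conjTranspose, Matrix.conjTranspose_mul,
      Matrix.conjTranspose_kronecker, pauli_conjTranspose, pauli_conjTranspose, hA.eq,
      Matrix.trace_mul_comm]
  exact h

theorem ofReal_pauliTrace_re {A : TwoQubitOp} (hA : A.IsHermitian) (k l : Fin 4) :
    (((pauliTrace k l A).re : ℝ) : ℂ) = pauliTrace k l A :=
  Complex.ext (by simp) (by simp [pauliTrace_im hA])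

theorem pauliTrace_zero_zero (A : TwoQubitOp) : pauliTrace 0 0 A = A.trace := by
  simp [pauliTrace, pauli]

/-- The matrix `Tr[(σᵃ ⊗ σᵇ) A]` of two-point correlations. -/
def correlation (A : TwoQubitOp) : Matrix (Fin 3) (Fin 3) ℝ :=
  Matrix.of fun a b => (pauliTrace a.succ b.succ A).re

theorem Matrix.trace_eq_rank_of_isIdempotentElem {ι : Type*} [Fintype ι] [DecidableEq ι]
    {A : Matrix ι ι ℂ} (hA : IsIdempotentElem A) : A.trace = A.rank := by
  have h : IsIdempotentElem (Matrix.toLin' A) := by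
    rw [IsIdempotentElem, Module.End.mul_eq_comp, ← Matrix.toLin'_mul, hA.eq]
  have := ((LinearMap.isProj_range_iff_isIdempotentElem _).mpr h).trace
  rw [Matrix.trace_toLin'_eq] at this
  rw [this]; rfl

theorem StrictlyQuadratic.eq_pauli_sum {A : TwoQubitOp} (hA : StrictlyQuadratic A) :
    A = (1 / 4 : ℂ) • (A.trace • (1 : TwoQubitOp) +
      ∑ a : Fin 3, ∑ b : Fin 3, pauliTrace a.succ b.succ A • (pauli a.succ ⊗ₖ pauli b.succ)) := by
  conv_lhs => rw [pauli_expansion A]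
  rw [Fin.sum_univ_succ, Fin.sum_univ_succ]
  have h1 : ∀ b : Fin 3, pauliCoeff 0 b.succ A = 0 := fun b => hA.2 _ (Fin.succ_ne_zero b)
  have h2 : ∀ a : Fin 3, pauliCoeff a.succ 0 A = 0 := fun a => hA.1 _ (Fin.succ_ne_zero a)
  have h3 : ∀ a : Fin 3, ∑ l, pauliCoeff a.succ l A • (pauli a.succ ⊗ₖ pauli l) =
      ∑ b : Fin 3, pauliCoeff a.succ b.succ A • (pauli a.succ ⊗ₖ pauli b.succ) := fun a => by
    rw [Fin.sum_univ_succ, h2, zero_smul, zero_add]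
  simp only [h1, h3, zero_smul, Finset.sum_const_zero, add_zero, smul_add, Finset.smul_sum,
    smul_smul]
  congr 1
  · rw [pauliCoeff, pauliTrace_zero_zero]
    simp [pauli, div_eq_inv_mul]
  · simp [pauliCoeff, div_eq_inv_mul]

/-- The two-qubit operator with given trace and correlations, and no local terms. -/
def ofCorrelation (m : ℂ) (c : Fin 3 → Fin 3 → ℂ) : TwoQubitOp :=
  Matrix.of fun p q => (1 / 4 : ℂ) * (![![![![m + c 2 2, 0], ![0, c 0 0 - c 1 1 - Complex.I * (c 0 1 + c 1 0)]],
      ![![0, m - c 2 2], ![c 0 0 + c 1 1 + Complex.I * (c 0 1 - c 1 0), 0]]],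
     ![![![0, c 0 0 + c 1 1 - Complex.I * (c 0 1 - c 1 0)], ![m - c 2 2, 0]],
      ![![c 0 0 - c 1 1 + Complex.I * (c 0 1 + c 1 0), 0], ![0, m + c 2 2]]]] p.1 p.2 q.1 q.2 +
    ![![![![0, c 2 0 - Complex.I * c 2 1], ![c 0 2 - Complex.I * c 1 2, 0]],
      ![![c 2 0 + Complex.I * c 2 1, 0], ![0, -(c 0 2 - Complex.I * c 1 2)]]],
     ![![![c 0 2 + Complex.I * c 1 2, 0], ![0, -(c 2 0 - Complex.I * c 2 1)]],
      ![![0, -(c 0 2 + Complex.I * c 1 2)], ![-(c 2 0 + Complex.I * c 2 1), 0]]]] p.1 p.2 q.1 q.2)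

theorem StrictlyQuadratic.eq_ofCorrelation {A : TwoQubitOp} (hA : StrictlyQuadratic A) :
    A = ofCorrelation A.trace fun a b => pauliTrace a.succ b.succ A := by
  conv_lhs => rw [hA.eq_pauli_sum]
  generalize A.trace = m
  have : ∀ c : Fin 3 → Fin 3 → ℂ, (1 / 4 : ℂ) • (m • (1 : TwoQubitOp) +
      ∑ a : Fin 3, ∑ b : Fin 3, c a b • (pauli a.succ ⊗ₖ pauli b.succ)) = ofCorrelation m c := by
    intro c
    ext ⟨i, j⟩ ⟨k, l⟩
    simp only [Matrix.smul_apply, Matrix.add_apply, Matrix.kronecker_apply,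
      Fin.sum_univ_three, ofCorrelation, Matrix.of_apply, smul_eq_mul]
    congr 1
    fin_cases i <;> fin_cases j <;> fin_cases k <;> fin_cases l <;>
      simp [pauli] <;> ring
  exact this _

theorem pauliTrace_ofCorrelation_sq_zero (m : ℂ) (c : Fin 3 → Fin 3 → ℂ) :
    pauliTrace 0 0 (ofCorrelation m c * ofCorrelation m c) = (m ^ 2 + ∑ a, ∑ b, c a b ^ 2) / 4 := by
  simp [pauliTrace, pauli, Matrix.trace, Matrix.mul_apply, Fintype.sum_prod_type, ofCorrelation,
    Fin.sum_univ_three]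
  ring_nf
  simp [Complex.I_sq]
  ring

-- In the square, the identity term gives `2m c`. Two correlation terms differing in exactly one
-- factor anticommute and cancel. Terms differing in both factors commute, and the two factors `i`
-- of `σᵃσᵇ = iεσᶜ` combine to minus a signed 2×2 minor.
set_option maxHeartbeats 2000000 in
theorem pauliTrace_ofCorrelation_sq (m : ℂ) (c : Fin 3 → Fin 3 → ℂ) (a b : Fin 3) :
    pauliTrace a.succ b.succ (ofCorrelation m c * ofCorrelation m c) =
      (m * c a b - (Matrix.of c).adjugate b a) / 2 := by
  rw [Matrix.adjugate_fin_three]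
  have hI : Complex.I ^ 2 = -1 := Complex.I_sq
  fin_cases a <;> fin_cases b <;>
  · simp [pauliTrace, pauli, Matrix.trace, Matrix.mul_apply, Fintype.sum_prod_type, ofCorrelation]
    generalize Complex.I = i at hI ⊢
    grind

end Pauli

/-! ### Correlation matrices of strictly quadratic projectors. -/

section Projector

theorem IsStarProjection.pauli_structure {A : TwoQubitOp} (hP : IsStarProjection A)
    (hA : StrictlyQuadratic A) :
    (correlation A).adjugate = ((A.rank : ℝ) - 2) • (correlation A).transpose ∧
      ∑ a, ∑ b, correlation A a b ^ 2 = A.rank * (4 - A.rank) := by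
  have hH : A.IsHermitian := hP.isSelfAdjoint
  have hc : ∀ a b : Fin 3, pauliTrace a.succ b.succ A = ((correlation A a b : ℝ) : ℂ) :=
    fun a b => (ofReal_pauliTrace_re hH _ _).symm
  have htr : A.trace = (A.rank : ℂ) := Matrix.trace_eq_rank_of_isIdempotentElem hP.isIdempotentElem
  have hof := hA.eq_ofCorrelation
  have hsq : A * A = A := hP.isIdempotentElem.eq
  constructor
  · ext b a
    have h := pauliTrace_ofCorrelation_sq A.trace (fun a b => pauliTrace a.succ b.succ A) a b
    rw [← hof, hsq, htr] at h
    simp only [hc] at h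
    have hmap : (Matrix.of fun a b => ((correlation A a b : ℝ) : ℂ)) =
        Complex.ofRealHom.mapMatrix (correlation A) := rfl
    rw [hmap, ← RingHom.map_adjugate] at h
    simp only [RingHom.mapMatrix_apply, Matrix.map_apply, Complex.ofRealHom_eq_coe] at h
    have h' : correlation A a b = (A.rank * correlation A a b - (correlation A).adjugate b a) / 2 := by
      exact_mod_cast h
    rw [Matrix.smul_apply, Matrix.transpose_apply, smul_eq_mul]
    linarith
  · have h := pauliTrace_ofCorrelation_sq_zero A.trace (fun a b => pauliTrace a.succ b.succ A)
    rw [← hof, hsq, pauliTrace_zero_zero, htr] at h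
    simp only [hc] at h
    have h' : (A.rank : ℝ) = ((A.rank : ℝ) ^ 2 + ∑ a, ∑ b, correlation A a b ^ 2) / 4 := by
      exact_mod_cast h
    linarith

end Projector

/-! ### Tensor products and energies of product states. -/

section TensorProd

variable {n : ℕ}

theorem tensorProd_mul (ρ τ : Fin n → Matrix (Fin 2) (Fin 2) ℂ) :
    tensorProd ρ * tensorProd τ = tensorProd fun i => ρ i * τ i := by
  ext x y
  simp only [tensorProd, Matrix.mul_apply, Matrix.of_apply, ← Finset.prod_mul_distrib]
  rw [Finset.prod_univ_sum, Fintype.piFinset_univ]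

theorem trace_tensorProd (ρ : Fin n → Matrix (Fin 2) (Fin 2) ℂ) :
    (tensorProd ρ).trace = ∏ i, (ρ i).trace := by
  simp only [tensorProd, Matrix.trace, Matrix.diag, Matrix.of_apply]
  rw [Finset.prod_univ_sum, Fintype.piFinset_univ]

theorem tensorProd_one : tensorProd (fun _ : Fin n => 1) = 1 := by
  ext x y
  simp only [tensorProd, Matrix.of_apply, Matrix.one_apply]
  by_cases h : x = y
  · simp [h]
  · obtain ⟨i, hi⟩ := Function.ne_iff.mp h
    rw [if_neg h]
    exact Finset.prod_eq_zero (Finset.mem_univ i) (if_neg hi)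

theorem conjTranspose_tensorProd (ρ : Fin n → Matrix (Fin 2) (Fin 2) ℂ) :
    (tensorProd ρ).conjTranspose = tensorProd fun i => (ρ i).conjTranspose := by
  ext x y
  simp [tensorProd, Matrix.conjTranspose_apply]

/-- The one-qubit operator `B` acting on qubit `i`. -/
def onQubit (i : Fin n) (B : Matrix (Fin 2) (Fin 2) ℂ) : QubitOp n :=
  tensorProd (Function.update (fun _ => 1) i B)

theorem onQubit_apply (i : Fin n) (B : Matrix (Fin 2) (Fin 2) ℂ) (x y : Fin n → Fin 2) :
    onQubit i B x y = B (x i) (y i) *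
      ∏ m ∈ Finset.univ.erase i, (1 : Matrix (Fin 2) (Fin 2) ℂ) (x m) (y m) := by
  simp only [onQubit, tensorProd, Matrix.of_apply]
  rw [← Finset.mul_prod_erase _ _ (Finset.mem_univ i), Function.update_self]
  congr 1
  refine Finset.prod_congr rfl fun m hm => ?_
  rw [Function.update_of_ne (Finset.ne_of_mem_erase hm)]

theorem onQubit_add (i : Fin n) (B C : Matrix (Fin 2) (Fin 2) ℂ) :
    onQubit i (B + C) = onQubit i B + onQubit i C := by
  ext x y
  simp only [onQubit_apply, Matrix.add_apply, add_mul]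

theorem onQubit_one (i : Fin n) : onQubit i 1 = 1 := by
  rw [onQubit, ← tensorProd_one]
  congr 1
  exact Function.update_eq_self i _

theorem onQubit_mul (i : Fin n) (B C : Matrix (Fin 2) (Fin 2) ℂ) :
    onQubit i B * onQubit i C = onQubit i (B * C) := by
  rw [onQubit, onQubit, tensorProd_mul, onQubit]
  congr 1
  ext1 m
  by_cases h : m = i
  · subst h; simp
  · simp [h]

theorem conjTranspose_onQubit (i : Fin n) (B : Matrix (Fin 2) (Fin 2) ℂ) :
    (onQubit i B).conjTranspose = onQubit i B.conjTranspose := by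
  rw [onQubit, conjTranspose_tensorProd, onQubit]
  congr 1
  ext1 m
  by_cases h : m = i
  · subst h; simp
  · simp [h]

theorem onQubit_commute {i j : Fin n} (hij : i ≠ j) (B C : Matrix (Fin 2) (Fin 2) ℂ) :
    onQubit i B * onQubit j C = onQubit j C * onQubit i B := by
  rw [onQubit, onQubit, tensorProd_mul, tensorProd_mul]
  congr 1
  ext1 m
  by_cases h : m = i
  · subst h; simp [hij]
  · simp [h]

theorem onQubits_kronecker {i j : Fin n} (hij : i ≠ j) (B C : Matrix (Fin 2) (Fin 2) ℂ) :
    onQubits i j (B ⊗ₖ C) = onQubit i B * onQubit j C := by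
  rw [onQubit, onQubit, tensorProd_mul]
  ext x y
  simp only [onQubits, tensorProd, Matrix.of_apply, Matrix.kronecker_apply]
  split_ifs with h
  · rw [Finset.prod_eq_mul i j hij]
    · simp [hij, hij.symm]
    · intro m _ hm
      simp [hm.1, hm.2, h m hm.1 hm.2]
    · simp
    · simp
  · push Not at h
    obtain ⟨m, h1, h2, h3⟩ := h
    refine (Finset.prod_eq_zero (Finset.mem_univ m) ?_).symm
    simp [h1, h2, h3]

/-- `onQubits` as a linear map. -/
def onQubitsLin (i j : Fin n) : TwoQubitOp →ₗ[ℂ] QubitOp n where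
  toFun := onQubits i j
  map_add' A B := by
    ext x y
    simp only [onQubits, Matrix.of_apply, Matrix.add_apply]
    split_ifs <;> simp
  map_smul' c A := by
    ext x y
    simp only [onQubits, Matrix.of_apply, Matrix.smul_apply, RingHom.id_apply]
    split_ifs <;> simp

theorem onQubits_eq_sum {i j : Fin n} (hij : i ≠ j) (A : TwoQubitOp) :
    onQubits i j A = ∑ k, ∑ l, pauliCoeff k l A • (onQubit i (pauli k) * onQubit j (pauli l)) := by
  conv_lhs => rw [pauli_expansion A]
  change onQubitsLin i j _ = _
  simp only [map_sum, map_smul]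
  refine Finset.sum_congr rfl fun k _ => Finset.sum_congr rfl fun l _ => ?_
  congr 1
  exact onQubits_kronecker hij _ _

theorem trace_onQubit_mul_onQubit_mul_tensorProd {i j : Fin n} (hij : i ≠ j)
    (B C : Matrix (Fin 2) (Fin 2) ℂ) {ρ : Fin n → Matrix (Fin 2) (Fin 2) ℂ}
    (hρ : ∀ m, (ρ m).trace = 1) :
    (onQubit i B * onQubit j C * tensorProd ρ).trace = (B * ρ i).trace * (C * ρ j).trace := by
  rw [onQubit, onQubit, tensorProd_mul, tensorProd_mul, trace_tensorProd,
    Finset.prod_eq_mul i j hij]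
  · simp [hij, hij.symm]
  · intro m _ hm
    simp [hm.1, hm.2, hρ]
  · simp
  · simp

/-- The qubit state with Bloch vector `θ`. -/
def blochState (θ : Fin 3 → ℝ) : Matrix (Fin 2) (Fin 2) ℂ :=
  (1 / 2 : ℂ) • (1 + ∑ k : Fin 3, (θ k : ℂ) • pauli k.succ)

theorem trace_blochState (θ : Fin 3 → ℝ) : (blochState θ).trace = 1 := by
  simp [blochState, Fin.sum_univ_three, pauli, Matrix.trace, Fin.sum_univ_two]
  ring

theorem trace_pauli_mul_blochState (θ : Fin 3 → ℝ) (a : Fin 3) :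
    (pauli a.succ * blochState θ).trace = θ a := by
  have hI : Complex.I ^ 2 = -1 := Complex.I_sq
  rw [Matrix.trace_fin_two, Matrix.mul_apply, Matrix.mul_apply, Fin.sum_univ_two, Fin.sum_univ_two]
  fin_cases a <;>
  · simp [blochState, Fin.sum_univ_three, pauli]
    generalize Complex.I = i at hI ⊢
    grind

theorem trace_onQubits_mul_blochState {i j : Fin n} (hij : i ≠ j) {A : TwoQubitOp}
    (hA : StrictlyQuadratic A) (hH : A.IsHermitian) (θ : Fin n → Fin 3 → ℝ) :
    (onQubits i j A * tensorProd fun m => blochState (θ m)).trace.re =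
      (A.trace.re + ∑ a, ∑ b, correlation A a b * (θ i a * θ j b)) / 4 := by
  have h0 : ∀ B : Matrix (Fin 2) (Fin 2) ℂ, pauli 0 * B = B := fun B => by simp [pauli]
  have hc : ∀ a b : Fin 3, pauliCoeff a.succ b.succ A = ((correlation A a b : ℝ) : ℂ) / 4 :=
    fun a b => by rw [pauliCoeff, ← ofReal_pauliTrace_re hH]; rfl
  have h1 : ∀ b : Fin 3, pauliCoeff 0 b.succ A = 0 := fun b => hA.2 _ (Fin.succ_ne_zero b)
  have h2 : ∀ a : Fin 3, pauliCoeff a.succ 0 A = 0 := fun a => hA.1 _ (Fin.succ_ne_zero a)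
  have h3 : pauliCoeff 0 0 A = A.trace / 4 := by rw [pauliCoeff, pauliTrace_zero_zero]
  rw [onQubits_eq_sum hij]
  simp only [Matrix.sum_mul, Matrix.trace_sum, Matrix.smul_mul, Matrix.trace_smul,
    trace_onQubit_mul_onQubit_mul_tensorProd hij _ _ fun m => trace_blochState (θ m)]
  rw [Fin.sum_univ_succ, Fin.sum_univ_succ]
  simp only [Fin.sum_univ_succ (n := 3), h0, h1, h2, h3, hc, trace_blochState,
    trace_pauli_mul_blochState, smul_eq_mul, zero_mul, Finset.sum_const_zero, add_zero,
    zero_add, mul_one]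
  have e : ∑ a : Fin 3, ∑ b : Fin 3, ((correlation A a b : ℝ) : ℂ) / 4 * ((θ i a : ℂ) * (θ j b : ℂ)) =
      (((∑ a, ∑ b, correlation A a b * (θ i a * θ j b)) / 4 : ℝ) : ℂ) := by
    push_cast
    simp only [Finset.sum_div]
    exact Finset.sum_congr rfl fun a _ => Finset.sum_congr rfl fun b _ => by ring
  rw [e, Complex.add_re, Complex.ofReal_re, show (A.trace / 4).re = A.trace.re / 4 by
    rw [show (4 : ℂ) = ((4 : ℝ) : ℂ) by norm_num, Complex.div_ofReal_re]]
  ring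

end TensorProd

/-! ### The semidefinite program relaxes the largest eigenvalue. -/

section Relaxation

variable {n : ℕ}

/-- The expectation of an observable in the (unnormalized) state `ψ`. -/
def expect (ψ : (Fin n → Fin 2) → ℂ) (Y : QubitOp n) : ℂ := star ψ ⬝ᵥ Y.mulVec ψ

theorem expect_add (ψ : (Fin n → Fin 2) → ℂ) (Y Z : QubitOp n) :
    expect ψ (Y + Z) = expect ψ Y + expect ψ Z := by
  simp [expect, Matrix.add_mulVec, dotProduct_add]

theorem expect_smul (ψ : (Fin n → Fin 2) → ℂ) (c : ℂ) (Y : QubitOp n) :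
    expect ψ (c • Y) = c * expect ψ Y := by
  simp [expect, Matrix.smul_mulVec, dotProduct_smul]

/-- `expect` as a linear functional. -/
def expectLin (ψ : (Fin n → Fin 2) → ℂ) : QubitOp n →ₗ[ℂ] ℂ where
  toFun := expect ψ
  map_add' := expect_add ψ
  map_smul' := expect_smul ψ

theorem expect_sum {ι : Type*} (ψ : (Fin n → Fin 2) → ℂ) (s : Finset ι) (f : ι → QubitOp n) :
    expect ψ (∑ i ∈ s, f i) = ∑ i ∈ s, expect ψ (f i) := map_sum (expectLin ψ) f s

theorem expect_conjTranspose_mul (ψ : (Fin n → Fin 2) → ℂ) (Y Z : QubitOp n) :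
    expect ψ (Y.conjTranspose * Z) = star (Y.mulVec ψ) ⬝ᵥ Z.mulVec ψ := by
  rw [expect, ← Matrix.mulVec_mulVec, Matrix.dotProduct_mulVec, ← Matrix.star_mulVec]

theorem expect_conjTranspose (ψ : (Fin n → Fin 2) → ℂ) (Y : QubitOp n) :
    expect ψ Y.conjTranspose = star (expect ψ Y) := by
  rw [expect, expect, Matrix.dotProduct_mulVec, ← Matrix.star_mulVec, Matrix.star_dotProduct]

theorem pauli_mul_self (k : Fin 4) : pauli k * pauli k = 1 := by
  ext i j
  fin_cases k <;> fin_cases i <;> fin_cases j <;> simp [pauli]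

theorem pauli_anticomm {k l : Fin 3} (h : k ≠ l) :
    pauli k.succ * pauli l.succ + pauli l.succ * pauli k.succ = 0 := by
  ext i j
  fin_cases k <;> fin_cases l <;> first | exact absurd rfl h | skip
  all_goals fin_cases i <;> fin_cases j <;> simp [pauli]

theorem pauliTrace_kronecker (k l p q : Fin 4) :
    pauliTrace k l (pauli p ⊗ₖ pauli q) = if k = p ∧ l = q then 4 else 0 := by
  have h : ∀ k p : Fin 4, (pauli k * pauli p).trace = if k = p then 2 else 0 := by
    intro k p
    rw [Matrix.trace_fin_two, Matrix.mul_apply, Matrix.mul_apply, Fin.sum_univ_two,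
      Fin.sum_univ_two]
    fin_cases k <;> fin_cases p <;> simp [pauli] <;> norm_num
  rw [pauliTrace, ← Matrix.mul_kronecker_mul, Matrix.trace_kronecker, h, h]
  split_ifs <;> simp_all; norm_num

/-- The Pauli operator of an index of the moment matrix. -/
def momentOp : MomentIndex n → QubitOp n
  | none => 1
  | some p => onQubit p.1 (pauli p.2.succ)

theorem momentOp_conjTranspose (p : MomentIndex n) : (momentOp p).conjTranspose = momentOp p := by
  rcases p with _ | p
  · simp [momentOp]
  · simp [momentOp, conjTranspose_onQubit, pauli_conjTranspose]

theorem momentOp_mul_self (p : MomentIndex n) : momentOp p * momentOp p = 1 := by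
  rcases p with _ | p
  · simp [momentOp]
  · simp only [momentOp]
    rw [onQubit_mul, pauli_mul_self, onQubit_one]

/-- The moment matrix of `ψ`. -/
def momentMatrix (ψ : (Fin n → Fin 2) → ℂ) : Matrix (MomentIndex n) (MomentIndex n) ℝ :=
  Matrix.of fun p q => (expect ψ (momentOp p * momentOp q)).re

/-- The marginal of `ψ` on two qubits. -/
def marginal (ψ : (Fin n → Fin 2) → ℂ) (i j : Fin n) : TwoQubitOp :=
  ∑ k, ∑ l, (expect ψ (onQubit i (pauli k) * onQubit j (pauli l)) / 4) • (pauli k ⊗ₖ pauli l)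

theorem pauliTrace_marginal (ψ : (Fin n → Fin 2) → ℂ) (i j : Fin n) (k l : Fin 4) :
    pauliTrace k l (marginal ψ i j) = expect ψ (onQubit i (pauli k) * onQubit j (pauli l)) := by
  have h : pauliTrace k l (marginal ψ i j) = ∑ p, ∑ q,
      (expect ψ (onQubit i (pauli p) * onQubit j (pauli q)) / 4) *
        pauliTrace k l (pauli p ⊗ₖ pauli q) := by
    simp only [pauliTrace, marginal, Matrix.mul_sum, Matrix.trace_sum, Matrix.mul_smul,
      Matrix.trace_smul, smul_eq_mul]
  rw [h]
  simp only [pauliTrace_kronecker]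
  rw [Finset.sum_eq_single k, Finset.sum_eq_single l]
  · simp
  · intro q _ hq; simp [hq.symm]
  · simp
  · intro p _ hp; simp [hp.symm]
  · simp

/-- Duality identifies `marginal`, defined through Pauli coefficients, with the reduced state of
`ψ`; its positivity is read off from this. -/
theorem trace_mul_marginal (ψ : (Fin n → Fin 2) → ℂ) {i j : Fin n} (hij : i ≠ j) (B : TwoQubitOp) :
    (B * marginal ψ i j).trace = expect ψ (onQubits i j B) := by
  rw [onQubits_eq_sum hij, expect_sum]
  conv_lhs => rw [pauli_expansion B]
  rw [Matrix.sum_mul, Matrix.trace_sum]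
  refine Finset.sum_congr rfl fun k _ => ?_
  rw [Matrix.sum_mul, Matrix.trace_sum, expect_sum]
  refine Finset.sum_congr rfl fun l _ => ?_
  rw [Matrix.smul_mul, Matrix.trace_smul, expect_smul, ← pauliTrace_marginal]
  rfl

theorem conjTranspose_onQubits (i j : Fin n) (B : TwoQubitOp) :
    (onQubits i j B).conjTranspose = onQubits i j B.conjTranspose := by
  ext x y
  simp only [onQubits, Matrix.conjTranspose_apply, Matrix.of_apply, eq_comm (a := y _)]
  split_ifs <;> simp

theorem onQubits_kronecker_mul {i j : Fin n} (hij : i ≠ j) (C D : Matrix (Fin 2) (Fin 2) ℂ)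
    (B : TwoQubitOp) : onQubits i j (C ⊗ₖ D * B) = onQubits i j (C ⊗ₖ D) * onQubits i j B := by
  conv_lhs => rw [pauli_expansion B]
  rw [onQubits_eq_sum hij B]
  change onQubitsLin i j _ = _
  simp only [Matrix.mul_sum, Matrix.mul_smul, map_sum, map_smul, ← Matrix.mul_kronecker_mul]
  refine Finset.sum_congr rfl fun k _ => Finset.sum_congr rfl fun l _ => ?_
  congr 1
  change onQubits i j _ = _
  rw [onQubits_kronecker hij, onQubits_kronecker hij, ← onQubit_mul, ← onQubit_mul]
  simp only [Matrix.mul_assoc]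
  congr 1
  rw [← Matrix.mul_assoc, ← Matrix.mul_assoc, onQubit_commute hij]

theorem onQubits_mul {i j : Fin n} (hij : i ≠ j) (A B : TwoQubitOp) :
    onQubits i j (A * B) = onQubits i j A * onQubits i j B := by
  conv_lhs => rw [pauli_expansion A]
  rw [onQubits_eq_sum hij A]
  change onQubitsLin i j _ = _
  simp only [Matrix.sum_mul, Matrix.smul_mul, map_sum, map_smul]
  refine Finset.sum_congr rfl fun k _ => Finset.sum_congr rfl fun l _ => ?_
  congr 1
  change onQubits i j _ = _
  rw [onQubits_kronecker_mul hij, onQubits_kronecker hij]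

theorem posSemidef_marginal (ψ : (Fin n → Fin 2) → ℂ) {i j : Fin n} (hij : i ≠ j) :
    (marginal ψ i j).PosSemidef := by
  refine Matrix.PosSemidef.of_dotProduct_mulVec_nonneg ?_ fun x => ?_
  · rw [Matrix.IsHermitian, marginal]
    simp only [Matrix.conjTranspose_sum, Matrix.conjTranspose_smul, Matrix.conjTranspose_kronecker,
      pauli_conjTranspose]
    refine Finset.sum_congr rfl fun k _ => Finset.sum_congr rfl fun l _ => ?_
    congr 1
    rw [star_div₀, ← expect_conjTranspose, Matrix.conjTranspose_mul, conjTranspose_onQubit,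
      conjTranspose_onQubit, pauli_conjTranspose, pauli_conjTranspose, onQubit_commute hij]
    simp
  -- The basis vector is an arbitrary unit vector: it makes `xx† = CC†`, whose expectation in `ψ` is
  -- a squared norm because `onQubits` is a *-homomorphism.
  · set C : TwoQubitOp := Matrix.vecMulVec x (Pi.single (0, 0) 1) with hC
    have h1 : C * C.conjTranspose = Matrix.vecMulVec x (star x) := by
      rw [hC, Matrix.conjTranspose_vecMulVec, Matrix.vecMulVec_mul_vecMulVec]
      simp
    have h2 : star x ⬝ᵥ (marginal ψ i j).mulVec x =
        (Matrix.vecMulVec x (star x) * marginal ψ i j).trace := by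
      rw [Matrix.vecMulVec_mul, Matrix.trace_vecMulVec, Matrix.dotProduct_mulVec, dotProduct_comm]
    rw [h2, ← h1, trace_mul_marginal ψ hij, onQubits_mul hij, ← conjTranspose_onQubits]
    have h3 := expect_conjTranspose_mul ψ (onQubits i j C).conjTranspose (onQubits i j C).conjTranspose
    rw [Matrix.conjTranspose_conjTranspose] at h3
    rw [h3]
    exact dotProduct_star_self_nonneg _

/-- The entries are real parts of inner products of the vectors `momentOp p ψ`, so this is a Gram
matrix for the underlying real inner product. -/
theorem momentMatrix_posSemidef (ψ : (Fin n → Fin 2) → ℂ) : (momentMatrix ψ).PosSemidef := by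
  have hentry : ∀ p q, momentMatrix ψ p q =
      (star ((momentOp p).mulVec ψ) ⬝ᵥ (momentOp q).mulVec ψ).re := fun p q => by
    rw [← expect_conjTranspose_mul, momentOp_conjTranspose]; rfl
  refine Matrix.PosSemidef.of_dotProduct_mulVec_nonneg ?_ fun x => ?_
  · ext p q
    have h := congrArg Complex.re
      (Matrix.star_dotProduct ((momentOp q).mulVec ψ) ((momentOp p).mulVec ψ))
    rw [Matrix.conjTranspose_apply, hentry, hentry, h]
    simp
  · have h : star x ⬝ᵥ (momentMatrix ψ).mulVec x =
        (star (∑ p, (x p : ℂ) • (momentOp p).mulVec ψ) ⬝ᵥ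
          ∑ q, (x q : ℂ) • (momentOp q).mulVec ψ).re := by
      rw [star_sum, sum_dotProduct, Complex.re_sum, dotProduct]
      refine Finset.sum_congr rfl fun p _ => ?_
      rw [dotProduct_sum, Complex.re_sum, Matrix.mulVec, dotProduct, Finset.mul_sum]
      refine Finset.sum_congr rfl fun q _ => ?_
      rw [star_smul, smul_dotProduct, dotProduct_smul, hentry, smul_eq_mul, smul_eq_mul,
        Complex.star_def, Complex.conj_ofReal, Complex.re_ofReal_mul, Complex.re_ofReal_mul,
        Pi.star_apply, star_trivial]
      ring
    rw [h]
    exact (Complex.nonneg_iff.mp (dotProduct_star_self_nonneg _)).1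

variable {E : Type*}

theorem sdpFeasible_moment (I : TwoLocalInstance n E) {ψ : (Fin n → Fin 2) → ℂ}
    (hψ : star ψ ⬝ᵥ ψ = 1) :
    I.SDPFeasible (momentMatrix ψ) (fun e => marginal ψ (I.fst e) (I.snd e)) := by
  have h1 : expect ψ 1 = 1 := by rw [expect, Matrix.one_mulVec, hψ]
  have hp0 : ∀ i : Fin n, onQubit i (pauli 0) = 1 := fun i => onQubit_one i
  have hre : ∀ Y : QubitOp n, Y.conjTranspose = Y → (((expect ψ Y).re : ℝ) : ℂ) = expect ψ Y := by
    intro Y hY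
    have := expect_conjTranspose ψ Y
    rw [hY] at this
    exact (Complex.conj_eq_iff_re.mp this.symm)
  constructor
  · simp [momentMatrix, momentOp, h1]
  · intro i k
    simp [momentMatrix, momentOp_mul_self, h1]
  · intro i k l hkl
    -- Anticommuting Hermitian operators have a product with purely imaginary expectation, which the
    -- real part in `momentMatrix` discards.
    have h := expect_add ψ (momentOp (some (i, k)) * momentOp (some (i, l)))
      (momentOp (some (i, l)) * momentOp (some (i, k)))
    have h0 : momentOp (some (i, k)) * momentOp (some (i, l)) +
      momentOp (some (i, l)) * momentOp (some (i, k)) = 0 := by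
      simp only [momentOp]
      rw [onQubit_mul, onQubit_mul, ← onQubit_add, pauli_anticomm hkl]
      ext x y
      simp [onQubit_apply]
    have hs : expect ψ (momentOp (some (i, l)) * momentOp (some (i, k))) =
        star (expect ψ (momentOp (some (i, k)) * momentOp (some (i, l)))) := by
      rw [← expect_conjTranspose, Matrix.conjTranspose_mul, momentOp_conjTranspose,
        momentOp_conjTranspose]
    rw [h0, hs] at h
    have h' := congrArg Complex.re h
    simp [expect] at h'
    simp only [momentMatrix, Matrix.of_apply, expect]
    linarith
  · intro e k l
    simp only [momentMatrix, Matrix.of_apply]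
    rw [pauliTrace_marginal]
    refine hre _ ?_
    rw [Matrix.conjTranspose_mul, momentOp_conjTranspose, momentOp_conjTranspose]
    exact (onQubit_commute (I.fst_ne_snd e) _ _).symm
  · intro e k
    simp only [momentMatrix, Matrix.of_apply]
    rw [pauliTrace_marginal, hp0, mul_one]
    simp only [momentOp, mul_one]
    refine hre _ ?_
    rw [conjTranspose_onQubit, pauli_conjTranspose]
  · intro e k
    simp only [momentMatrix, Matrix.of_apply]
    rw [pauliTrace_marginal, hp0, one_mul]
    simp only [momentOp, mul_one]
    refine hre _ ?_
    rw [conjTranspose_onQubit, pauli_conjTranspose]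
  · intro e
    refine ⟨posSemidef_marginal ψ (I.fst_ne_snd e), ?_⟩
    rw [← pauliTrace_zero_zero, pauliTrace_marginal, hp0, hp0, one_mul, h1]
  · exact momentMatrix_posSemidef ψ

theorem StrictlyQuadratic.pauliTrace_eq_zero {A : TwoQubitOp} (hA : StrictlyQuadratic A) :
    (∀ a : Fin 3, pauliTrace a.succ 0 A = 0) ∧ ∀ b : Fin 3, pauliTrace 0 b.succ A = 0 := by
  have h1 := fun a : Fin 3 => hA.1 _ (Fin.succ_ne_zero a)
  have h2 := fun a : Fin 3 => hA.2 _ (Fin.succ_ne_zero a)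
  simpa [pauliCoeff] using And.intro h1 h2

/-- Each correlation occurs twice by symmetry, turning eighths into quarters. -/
theorem trace_valueMatrix_mul {i j : Fin n} (hij : i ≠ j) {A : TwoQubitOp}
    (hA : StrictlyQuadratic A) {M : Matrix (MomentIndex n) (MomentIndex n) ℝ}
    (hM : ∀ p q, M p q = M q p) :
    (valueMatrix i j A * M).trace =
      (∑ a, ∑ b, correlation A a b * M (some (i, a)) (some (j, b))) / 4 := by
  obtain ⟨h1, h2⟩ := hA.pauliTrace_eq_zero
  have hV : ∀ p q, valueMatrix i j A p q = match p, q with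
      | some p, some q =>
        (if p.1 = i then if q.1 = j then correlation A p.2 q.2 / 8 else 0 else 0) +
          (if p.1 = j then if q.1 = i then correlation A q.2 p.2 / 8 else 0 else 0)
      | _, _ => 0 := by
    rintro (_ | p) (_ | q) <;>
      simp only [valueMatrix, Matrix.of_apply, h1, h2, Complex.zero_re, zero_div, ite_self]
    by_cases hp : p.1 = i
    · have : p.1 ≠ j := fun h => hij (hp.symm.trans h)
      simp [hp, hij, correlation]
    · simp [hp, correlation, ite_and]
  simp only [Matrix.trace, Matrix.diag, Matrix.mul_apply, Fintype.sum_option, hV, zero_mul,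
    Finset.sum_const_zero, zero_add, Fintype.sum_prod_type, add_mul, ite_mul,
    Finset.sum_add_distrib]
  have e1 : ∑ m, ∑ a, ∑ m', ∑ b, (if m = i then if m' = j then
      correlation A a b / 8 * M (some (m', b)) (some (m, a)) else 0 else 0) =
      ∑ a, ∑ b, correlation A a b / 8 * M (some (j, b)) (some (i, a)) := by
    rw [Finset.sum_eq_single i (by intro m _ hm; simp [hm]) (by simp)]
    refine Finset.sum_congr rfl fun a _ => ?_
    rw [Finset.sum_eq_single j (by intro m _ hm; simp [hm]) (by simp)]
    simp
  have e2 : ∑ m, ∑ a, ∑ m', ∑ b, (if m = j then if m' = i then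
      correlation A b a / 8 * M (some (m', b)) (some (m, a)) else 0 else 0) =
      ∑ a, ∑ b, correlation A a b / 8 * M (some (i, a)) (some (j, b)) := by
    rw [Finset.sum_eq_single j (by intro m _ hm; simp [hm]) (by simp), Finset.sum_comm (γ := Fin 3)]
    rw [Finset.sum_eq_single i (by intro m _ hm; simp [hm]) (by simp), Finset.sum_comm (γ := Fin 3)]
    simp
  rw [e1, e2, Finset.sum_div, ← Finset.sum_add_distrib]
  refine Finset.sum_congr rfl fun a _ => ?_
  rw [Finset.sum_div, ← Finset.sum_add_distrib]
  refine Finset.sum_congr rfl fun b _ => ?_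
  rw [hM (some (j, b))]
  ring

/-- The contribution of one edge to the relaxation is the energy of its marginal. -/
theorem edge_objective_eq {I : TwoLocalInstance n E}
    {M : Matrix (MomentIndex n) (MomentIndex n) ℝ} {ρ : E → TwoQubitOp} (hM : I.SDPFeasible M ρ)
    (e : E) (hA : StrictlyQuadratic (I.op e)) (hH : (I.op e).IsHermitian) :
    (I.op e * ρ e).trace.re = ((I.op e).trace.re + ∑ a, ∑ b, correlation (I.op e) a b *
      M (some (I.fst e, a)) (some (I.snd e, b))) / 4 ∧
    (I.op e).trace.re / 4 + (valueMatrix (I.fst e) (I.snd e) (I.op e) * M).trace =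
      (I.op e * ρ e).trace.re := by
  have hsym : ∀ p q, M p q = M q p := fun p q => by
    have := hM.posSemidef.isHermitian.apply q p
    simpa using this
  have key : (I.op e * ρ e).trace.re = ((I.op e).trace.re + ∑ a, ∑ b, correlation (I.op e) a b *
      M (some (I.fst e, a)) (some (I.snd e, b))) / 4 := by
    obtain ⟨h1, h2⟩ := hA.pauliTrace_eq_zero
    have hc : ∀ a b : Fin 3, pauliTrace a.succ b.succ (I.op e) =
        ((correlation (I.op e) a b : ℝ) : ℂ) := fun a b => (ofReal_pauliTrace_re hH _ _).symm
    have hexp : (I.op e * ρ e).trace = ∑ k, ∑ l, pauliCoeff k l (I.op e) * pauliTrace k l (ρ e) := by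
      conv_lhs => rw [pauli_expansion (I.op e)]
      simp only [Matrix.sum_mul, Matrix.trace_sum, Matrix.smul_mul, Matrix.trace_smul, smul_eq_mul]
      rfl
    rw [hexp, Fin.sum_univ_succ, Fin.sum_univ_succ]
    simp only [Fin.sum_univ_succ (n := 3), pauliCoeff, h1, h2, hc, ← hM.marginal_two,
      pauliTrace_zero_zero, (hM.density e).2, zero_div, zero_mul, Finset.sum_const_zero, add_zero,
      zero_add, mul_one]
    have e1 : ∑ a, ∑ b, ((correlation (I.op e) a b : ℝ) : ℂ) / 4 *
        ((M (some (I.fst e, a)) (some (I.snd e, b)) : ℝ) : ℂ) =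
        (((∑ a, ∑ b, correlation (I.op e) a b *
          M (some (I.fst e, a)) (some (I.snd e, b))) / 4 : ℝ) : ℂ) := by
      push_cast
      simp only [Finset.sum_div]
      exact Finset.sum_congr rfl fun a _ => Finset.sum_congr rfl fun b _ => by ring
    rw [e1, Complex.add_re, Complex.ofReal_re, show ((I.op e).trace / 4).re =
      (I.op e).trace.re / 4 by
        rw [show (4 : ℂ) = ((4 : ℝ) : ℂ) by norm_num, Complex.div_ofReal_re]]
    ring
  refine ⟨key, ?_⟩
  rw [key, trace_valueMatrix_mul (I.fst_ne_snd e) hA hsym]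
  ring

theorem isHermitian_hamiltonian [Fintype E] {I : TwoLocalInstance n E}
    (h : ∀ e, (I.op e).IsHermitian) : I.hamiltonian.IsHermitian := by
  rw [Matrix.IsHermitian, TwoLocalInstance.hamiltonian, Matrix.conjTranspose_sum]
  refine Finset.sum_congr rfl fun e _ => ?_
  rw [Matrix.conjTranspose_smul, conjTranspose_onQubits, (h e).eq]
  simp

/-- The semidefinite program is a relaxation of the largest eigenvalue. -/
theorem lambdaMax_le_sdpObjective [Fintype E] {I : TwoLocalInstance n E}
    (hH : ∀ e, (I.op e).IsHermitian) (hquad : ∀ e, StrictlyQuadratic (I.op e))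
    {M : Matrix (MomentIndex n) (MomentIndex n) ℝ} (hM : I.IsSDPOptimal M) :
    lambdaMax I.hamiltonian ≤ I.sdpObjective M := by
  have hHam := isHermitian_hamiltonian hH
  have hmem := (lambdaMax_isGreatest hHam).1
  rw [hHam.spectrum_real_eq_range_eigenvalues] at hmem
  obtain ⟨i, hi⟩ := hmem
  set ψ : (Fin n → Fin 2) → ℂ := WithLp.ofLp (hHam.eigenvectorBasis i) with hψdef
  have hψ : star ψ ⬝ᵥ ψ = 1 := by
    have h := hHam.eigenvectorBasis.inner_eq_one i
    rw [EuclideanSpace.inner_eq_star_dotProduct, dotProduct_comm] at h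
    exact h
  have hfeas := sdpFeasible_moment I hψ
  have hexp : expect ψ I.hamiltonian = (lambdaMax I.hamiltonian : ℂ) := by
    rw [expect, hψdef, hHam.mulVec_eigenvectorBasis, ← hψdef, hi, dotProduct_smul, hψ]
    simp
  have hsum : lambdaMax I.hamiltonian = I.sdpObjective (momentMatrix ψ) := by
    rw [← Complex.ofReal_re (lambdaMax I.hamiltonian), ← hexp, TwoLocalInstance.hamiltonian,
      expect_sum, Complex.re_sum, TwoLocalInstance.sdpObjective]
    refine Finset.sum_congr rfl fun e _ => ?_
    rw [expect_smul, Complex.re_ofReal_mul, (edge_objective_eq hfeas e (hquad e) (hH e)).2,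
      trace_mul_marginal ψ (I.fst_ne_snd e)]
  rw [hsum]
  exact hM.2 _ _ hfeas

end Relaxation

/-! ### The guarantee for a single edge. -/

section Rounding

theorem IsStarProjection.trace_mul_nonneg {A ρ : TwoQubitOp} (hP : IsStarProjection A)
    (hρ : ρ.PosSemidef) : 0 ≤ (A * ρ).trace.re := by
  have hH : A.conjTranspose = A := hP.isSelfAdjoint
  have h : (A * ρ).trace = (A * ρ * A.conjTranspose).trace := by
    rw [hH, Matrix.trace_mul_comm (A * ρ), ← Matrix.mul_assoc, hP.isIdempotentElem.eq]
  rw [h]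
  exact (Complex.nonneg_iff.mp (hρ.mul_mul_conjTranspose_same A).trace_nonneg).1

theorem IsStarProjection.trace_mul_le_one {A ρ : TwoQubitOp} (hP : IsStarProjection A)
    (hρ : IsDensityMatrix ρ) : (A * ρ).trace.re ≤ 1 := by
  have h := hP.one_sub.trace_mul_nonneg hρ.1
  rw [Matrix.sub_mul, Matrix.one_mul, Matrix.trace_sub, hρ.2] at h
  simpa using h

variable {E : Type*} [NormedAddCommGroup E] [InnerProductSpace ℝ E]

/-- Bessel's inequality, applied in both directions. -/
theorem isContraction_crossGram {x y : Fin 3 → E} (hx : Orthonormal ℝ x) (hy : Orthonormal ℝ y) :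
    IsContraction (crossGram x y) := by
  have key : ∀ {x y : Fin 3 → E}, Orthonormal ℝ x → Orthonormal ℝ y → ∀ v,
      ∑ a, (crossGram x y).mulVec v a ^ 2 ≤ ∑ a, v a ^ 2 := by
    intro x y hx hy v
    have h1 : ∀ a, (crossGram x y).mulVec v a = inner ℝ (x a) (∑ b, v b • y b) := fun a => by
      simp [crossGram, Matrix.mulVec, dotProduct, inner_sum, real_inner_smul_right, mul_comm]
    have h2 := hx.sum_inner_products_le (∑ b, v b • y b) (s := Finset.univ)
    rw [← real_inner_self_eq_norm_sq, hy.inner_sum] at h2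
    simp only [Real.norm_eq_abs, sq_abs] at h2
    simp_rw [h1]
    refine h2.trans (le_of_eq ?_)
    simp [pow_two]
  refine ⟨key hx hy, ?_⟩
  have ht : (crossGram x y).transpose = crossGram y x := by
    ext a b; simp [crossGram, real_inner_comm]
  rw [ht]
  exact key hy hx

variable [MeasurableSpace E] [BorelSpace E] [FiniteDimensional ℝ E]

/-- The bilinear form of `c` on the normalized coordinates. -/
def roundedForm (c : Matrix (Fin 3) (Fin 3) ℝ) (x y : Fin 3 → E) (r : E) : ℝ :=
  ∑ a, ∑ b, c a b * ((coordMap x r a * ‖coordMap x r‖⁻¹) * (coordMap y r b * ‖coordMap y r‖⁻¹))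

theorem integrable_roundedForm (c : Matrix (Fin 3) (Fin 3) ℝ) (x y : Fin 3 → E) :
    Integrable (roundedForm c x y) (stdGaussian E) := by
  have fld : ∀ (z : Fin 3 → E) a, PolyGrowth fun r => coordMap z r a * ‖coordMap z r‖⁻¹ :=
    fun z a => (radialWeight_inv.polyGrowth_coord_mul a).comp_clm (coordMap z)
  exact (PolyGrowth.sum _ fun a => PolyGrowth.sum _ fun b =>
    (PolyGrowth.const (c a b)).mul ((fld x a).mul (fld y b))).integrable

/-- The approximation guarantee for one projector. -/
theorem alphaSQ_mul_le_integral_roundedForm {k : ℕ} (hk : k = 1 ∨ k = 2 ∨ k = 3)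
    {A : TwoQubitOp} (hP : IsStarProjection A) (hA : StrictlyQuadratic A) (hrank : k ≤ A.rank)
    {x y : Fin 3 → E} (hx : Orthonormal ℝ x) (hy : Orthonormal ℝ y)
    (h0 : 0 ≤ A.rank + ∑ a, ∑ b, correlation A a b * crossGram x y a b)
    (h4 : A.rank + ∑ a, ∑ b, correlation A a b * crossGram x y a b ≤ 4) :
    alphaSQ k * (A.rank + ∑ a, ∑ b, correlation A a b * crossGram x y a b) ≤
      A.rank + ∫ r, roundedForm (correlation A) x y r ∂(stdGaussian E) := by
  obtain ⟨hadj, hn⟩ := hP.pauli_structure hA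
  have hle : A.rank ≤ 4 := by simpa using A.rank_le_card_height
  rcases Nat.lt_or_ge A.rank 4 with hlt | hge
  · have hm : A.rank = 1 ∨ A.rank = 2 ∨ A.rank = 3 := by omega
    obtain ⟨s, R, hs, hc, hR, hval⟩ := truncatedValue_ge hm hadj hn (isContraction_crossGram hx hy)
      (by linarith)
    have hα := mul_le_mul_of_nonneg_right (alphaSQ_le_of_le hk hm hrank) h0
    have hint : ∫ r, roundedForm (correlation A) x y r ∂(stdGaussian E) =
        s * ∫ r, roundedForm R x y r ∂(stdGaussian E) := by
      rw [← integral_const_mul, hc]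
      congr 1 with r
      simp only [roundedForm, Matrix.smul_apply, smul_eq_mul, Finset.mul_sum, mul_assoc]
    have hge : truncatedValue R (crossGram x y) ≤ ∫ r, roundedForm R x y r ∂(stdGaussian E) :=
      integral_rounded_ge hx hy hR
    rw [hint]
    have := mul_le_mul_of_nonneg_left hge hs
    linarith
  -- Full rank forces `c = 0`: both values are 1 and `alphaSQ k ≤ 1` suffices.
  · have hm : A.rank = 4 := le_antisymm hle hge
    have hc : ∀ a b, correlation A a b = 0 := by
      rw [hm] at hn
      norm_num at hn
      intro a b
      have h1 := (Finset.sum_eq_zero_iff_of_nonneg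
        (fun a _ => Finset.sum_nonneg fun b _ => sq_nonneg (correlation A a b))).mp hn a
        (Finset.mem_univ a)
      have h2 := (Finset.sum_eq_zero_iff_of_nonneg
        (fun b _ => sq_nonneg (correlation A a b))).mp h1 b (Finset.mem_univ b)
      exact pow_eq_zero_iff (two_ne_zero) |>.mp h2
    simp only [roundedForm, hc, zero_mul, Finset.sum_const_zero, add_zero, integral_zero, hm]
    have := alphaSQ_le_one hk
    norm_num
    linarith

end Rounding

/-! ### Energy of the rounded state and summation over edges. -/

section Main

variable {n d : ℕ}

theorem sgn_mul_self (x : ℝ) : sgn x * sgn x = 1 := by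
  unfold sgn; split_ifs <;> norm_num

/-- The three Cholesky vectors of a qubit. -/
def qubitVectors (v : MomentIndex n → EuclideanSpace ℝ (Fin d)) (i : Fin n) :
    Fin 3 → EuclideanSpace ℝ (Fin d) := fun a => v (some (i, a))

theorem roundingNorm_eq (v : MomentIndex n → EuclideanSpace ℝ (Fin d))
    (r : EuclideanSpace ℝ (Fin d)) (i : Fin n) :
    roundingNorm v r i = ‖coordMap (qubitVectors v i) r‖ := by
  rw [EuclideanSpace.norm_eq, roundingNorm]
  simp [qubitVectors]

/-- The sign squares to one, including the value chosen at 0, and a vanishing norm gives 0 on both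
sides. -/
theorem blochCoord_mul_blochCoord (v : MomentIndex n → EuclideanSpace ℝ (Fin d))
    (r : EuclideanSpace ℝ (Fin d)) (i j : Fin n) (a b : Fin 3) :
    blochCoord v r i a * blochCoord v r j b =
      (coordMap (qubitVectors v i) r a * ‖coordMap (qubitVectors v i) r‖⁻¹) *
        (coordMap (qubitVectors v j) r b * ‖coordMap (qubitVectors v j) r‖⁻¹) := by
  rw [blochCoord, blochCoord, roundingNorm_eq, roundingNorm_eq, coordMap_apply, coordMap_apply]
  simp only [qubitVectors, div_eq_mul_inv]
  linear_combination (inner ℝ (v (some (i, a))) r * ‖coordMap (qubitVectors v i) r‖⁻¹ *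
    (inner ℝ (v (some (j, b))) r * ‖coordMap (qubitVectors v j) r‖⁻¹)) *
    sgn_mul_self (inner ℝ (v none) r)

theorem orthonormal_qubitVectors {E : Type*} {M : Matrix (MomentIndex n) (MomentIndex n) ℝ}
    {I : TwoLocalInstance n E} {ρ : E → TwoQubitOp} (hM : I.SDPFeasible M ρ)
    {v : MomentIndex n → EuclideanSpace ℝ (Fin d)} (hv : IsCholesky M v) (i : Fin n) :
    Orthonormal ℝ (qubitVectors v i) := by
  rw [orthonormal_iff_ite]
  intro a b
  rw [qubitVectors, qubitVectors, ← hv]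
  split_ifs with h
  · rw [h, hM.diag]
  · exact hM.diag_block i a b h

variable {E : Type*} [Fintype E]

theorem roundedEnergy_eq {I : TwoLocalInstance n E} (hH : ∀ e, (I.op e).IsHermitian)
    (hquad : ∀ e, StrictlyQuadratic (I.op e))
    (v : MomentIndex n → EuclideanSpace ℝ (Fin d)) (r : EuclideanSpace ℝ (Fin d)) :
    I.roundedEnergy v r = ∑ e, I.weight e * (((I.op e).trace.re +
      roundedForm (correlation (I.op e)) (qubitVectors v (I.fst e)) (qubitVectors v (I.snd e)) r)
        / 4) := by
  have hst : roundedState v r = tensorProd fun i => blochState (blochCoord v r i) := rfl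
  rw [TwoLocalInstance.roundedEnergy, TwoLocalInstance.hamiltonian, Matrix.sum_mul,
    Matrix.trace_sum, Complex.re_sum]
  refine Finset.sum_congr rfl fun e _ => ?_
  rw [Matrix.smul_mul, Matrix.trace_smul, smul_eq_mul, Complex.re_ofReal_mul, hst,
    trace_onQubits_mul_blochState (I.fst_ne_snd e) (hquad e) (hH e)]
  simp only [roundedForm, blochCoord_mul_blochCoord]

end Main

end

theorem theorem2p3 (k : ℕ) (hk : k = 1 ∨ k = 2 ∨ k = 3)
    {n : ℕ} {E : Type*} [Fintype E] (I : TwoLocalInstance n E) (hI : I.IsQLHP k)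
    (hquad : ∀ e, StrictlyQuadratic (I.op e))
    (M : Matrix (MomentIndex n) (MomentIndex n) ℝ) (hM : I.IsSDPOptimal M)
    (d : ℕ) (v : MomentIndex n → EuclideanSpace ℝ (Fin d)) (hv : IsCholesky M v) :
    Integrable (fun r => I.roundedEnergy v r) (stdGaussian (EuclideanSpace ℝ (Fin d))) ∧
      alphaSQ k * lambdaMax I.hamiltonian ≤
        ∫ r, I.roundedEnergy v r ∂(stdGaussian (EuclideanSpace ℝ (Fin d))) := by
  have hH : ∀ e, (I.op e).IsHermitian := fun e => (hI.isProjector e).isSelfAdjoint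
  obtain ⟨ρ, hρ⟩ := hM.1
  have horth := orthonormal_qubitVectors hρ hv
  set F : E → EuclideanSpace ℝ (Fin d) → ℝ := fun e r => I.weight e * (((I.op e).trace.re +
    roundedForm (correlation (I.op e)) (qubitVectors v (I.fst e)) (qubitVectors v (I.snd e)) r) / 4)
    with hF
  have hFint : ∀ e, Integrable (F e) (stdGaussian (EuclideanSpace ℝ (Fin d))) := fun e =>
    ((((integrable_const _).add (integrable_roundedForm _ _ _)).div_const 4).const_mul _)
  have hEn : ∀ r, I.roundedEnergy v r = ∑ e, F e r := roundedEnergy_eq hH hquad v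
  simp_rw [hEn]
  refine ⟨integrable_finsetSum _ fun e _ => hFint e, ?_⟩
  rw [integral_finsetSum _ fun e _ => hFint e]
  have hα : 0 ≤ alphaSQ k := by
    have := linCoeff_sq_bounds
    rcases hk with rfl | rfl | rfl <;>
      simp only [alphaSQ_one, alphaSQ_two, alphaSQ_three] <;> linarith
  refine (mul_le_mul_of_nonneg_left (lambdaMax_le_sdpObjective hH hquad hM) hα).trans ?_
  rw [TwoLocalInstance.sdpObjective, Finset.mul_sum]
  refine Finset.sum_le_sum fun e _ => ?_
  obtain ⟨hval, hobj⟩ := edge_objective_eq hρ e (hquad e) (hH e)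
  have hP := hI.isProjector e
  have htr : (I.op e).trace.re = (I.op e).rank := by
    rw [Matrix.trace_eq_rank_of_isIdempotentElem hP.isIdempotentElem, Complex.natCast_re]
  have hcross : ∀ a b, M (some (I.fst e, a)) (some (I.snd e, b)) =
      crossGram (qubitVectors v (I.fst e)) (qubitVectors v (I.snd e)) a b := fun a b => hv _ _
  simp only [hcross, htr] at hval
  -- The marginal is a genuine density matrix, so the edge value `Tr[Pρ]` lies in `[0,1]`: the lower
  -- bound permits replacing `alphaSQ k` by the factor of the actual rank, and the upper bound is
  -- the one needed in rank 3.
  have h0 := hP.trace_mul_nonneg (hρ.density e).1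
  have h1 := hP.trace_mul_le_one (hρ.density e)
  have key := alphaSQ_mul_le_integral_roundedForm hk hP (hquad e) (hI.le_rank e)
    (horth (I.fst e)) (horth (I.snd e)) (by linarith) (by linarith)
  rw [hobj, hval]
  simp only [hF]
  rw [integral_const_mul, integral_div, integral_add (integrable_const _)
    (integrable_roundedForm _ _ _), htr]
  simp only [integral_const, probReal_univ, one_smul]
  have := mul_le_mul_of_nonneg_left key (hI.weight_nonneg e)
  linarith
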